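/- Let $\vartheta>0$. For $n\in\mathbb N=\{1,2,\dots\}$ and $\theta>0$ such that either $\theta\in\mathbb N$ or $\theta>n-1$, let $X_{n,\theta}$ be a random variable with the Stirling--Sibuya distribution $$ \mathbb P[X_{n,\theta}=k]={n\brace k}\,\frac{\theta(\theta-1)\cdots(\theta-k+1)}{\theta^n},\qquad k\in\{1,\dots,n\}, $$ where ${n\brace k}$ are the Stirling numbers of the second kind. Let $W_0$ be the principal branch of the Lambert function, i.e. the inverse of the conformal bijection $w\mapsto we^w$ from $\{a+bi: a>-b\cot b,\ b\in(-\pi,\pi)\}$ (with $0\cot 0:=1$) onto $\mathbb C\setminus(-\infty,-1/e]$. Put $$ L_3(z;\vartheta)=\frac1\vartheta+W_0\bigl(\vartheta^{-1}(e^{-z}-1)e^{-1/\vartheta}\bigr), $$ $$ \varphi_3(z;\vartheta)=(\vartheta-1)\log\vartheta-1+(\vartheta-1)\log L_3(z;\vartheta)+\vartheta\,(z+L_3(z;\vartheta)), $$ $$ \Psi_3(z;\vartheta)=\sqrt{\frac{\vartheta}{\vartheta L_3(z;\vartheta)+\vartheta-1}}, $$ with principal branches of the logarithm and the square root. Let $S$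 be the set of all $n\in\mathbb N$ such that $\vartheta n\in\mathbb N$ or $\vartheta n>n-1$ (so $S=\mathbb N$ if $\vartheta\ge 1$); below, $n$ runs through $S$. Then there is an open connected set $\mathcal D\subset\mathbb C$ with $\mathbb R\subset\mathcal D$ such that, for every $z\in\mathcal D$, the arguments of $W_0$, of the logarithm of $L_3$ and of the square root do not lie on the respective branch cuts $(-\infty,-1/e]$, $(-\infty,0]$, $(-\infty,0]$, and such that the sequence $(X_{n,\vartheta n})_{n\in S}$ converges mod-$\varphi$ on $\mathcal D$ with speed $w_n=n$. That is: the Laplace transforms $\mathbb E e^{zX_{n,\vartheta n}}$ exist on all of $\mathbb C$; $\varphi_3(\cdot;\vartheta)$ and $\Psi_3(\cdot;\vartheta)$ are analytic on $\mathcal D$; $\varphi_3(\cdot;\vartheta)$ is real-valued and strictly convex on $\mathbb R$; $\Psi_3(\cdot;\vartheta)$ does not vanish on $\mathbb R$; and, uniformly on compact subsets of $\mathcal D$, as $n\to\infty$ along $S$, $$ \frac{\mathbb E e^{zX_{n,\vartheta n}}}{e^{n\varphi_3(z;\vartheta)}}\longrightarrow \Psi_3(z;\vartheta). $$ Moreover,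 the convergence holds locally uniformly on $\mathcal D$ with rate $O(1/n)$: for every compact $K\subset\mathcal D$ there is a constant $C$ such that, for all $n\in S$ and all $z\in K$, $$ \left|\frac{\mathbb E e^{zX_{n,\vartheta n}}}{e^{n\varphi_3(z;\vartheta)}}-\Psi_3(z;\vartheta)\right|\le\frac Cn . $$ -/

import Mathlib

open Filter Topology MeasureTheory ProbabilityTheory

/-- The probability weight `S(n,k) θ(θ-1)⋯(θ-k+1) / θ^n` of the Stirling--Sibuya distribution. -/
noncomputable def stirlingSibuyaWeight (n : ℕ) (θ : ℝ) (k : ℕ) : ℝ :=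
  (Nat.stirlingSecond n k : ℝ) * (∏ i ∈ Finset.range k, (θ - i)) / θ ^ n

/-- The parameters for which the Stirling--Sibuya distribution is defined:
`n ≥ 1`, and `θ` is a positive integer or a real number with `θ > n - 1`. -/
def StirlingSibuyaAdmissible (n : ℕ) (θ : ℝ) : Prop :=
  1 ≤ n ∧ 0 < θ ∧ ((∃ m : ℕ, θ = m) ∨ (n : ℝ) - 1 < θ)

/-- The Stirling--Sibuya distribution with parameters `n` and `θ`, as a measure on `ℝ`
concentrated on `{1, …, n}`. -/
noncomputable def stirlingSibuya (n : ℕ) (θ : ℝ) : Measure ℝ :=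
  ∑ k ∈ Finset.Icc 1 n, ENNReal.ofReal (stirlingSibuyaWeight n θ k) • Measure.dirac (k : ℝ)

theorem sum_stirlingSecond_mul_prod (n : ℕ) (θ : ℝ) :
    ∑ k ∈ Finset.range (n + 1),
      (Nat.stirlingSecond n k : ℝ) * (∏ i ∈ Finset.range k, (θ - i)) = θ ^ n := by
  induction n with
  | zero => simp
  | succ n ih =>
    have hs : ∀ k : ℕ, (Nat.stirlingSecond (n + 1) (k + 1) : ℝ) *
        (∏ i ∈ Finset.range (k + 1), (θ - i)) =
        (((k + 1 : ℕ) : ℝ) * ((Nat.stirlingSecond n (k + 1) : ℝ) *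
          ∏ i ∈ Finset.range (k + 1), (θ - i))) +
        (θ - k) * ((Nat.stirlingSecond n k : ℝ) * ∏ i ∈ Finset.range k, (θ - i)) := by
      intro k
      rw [Nat.stirlingSecond_succ_succ, Finset.prod_range_succ]
      push_cast
      ring
    rw [Finset.sum_range_succ', Nat.stirlingSecond_succ_zero]
    simp only [hs, Nat.cast_zero, zero_mul, add_zero, Finset.sum_add_distrib]
    have h1 := Finset.sum_range_succ' (fun k : ℕ => ((k : ℕ) : ℝ) *
      ((Nat.stirlingSecond n k : ℝ) * ∏ i ∈ Finset.range k, (θ - i))) (n + 1)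
    have h2 := Finset.sum_range_succ (fun k : ℕ => ((k : ℕ) : ℝ) *
      ((Nat.stirlingSecond n k : ℝ) * ∏ i ∈ Finset.range k, (θ - i))) (n + 1)
    have h3 : (Nat.stirlingSecond n (n + 1) : ℝ) = 0 := by
      exact_mod_cast Nat.stirlingSecond_eq_zero_of_lt (Nat.lt_succ_self n)
    simp only [h3, Nat.cast_zero, zero_mul, mul_zero, add_zero] at h1 h2
    rw [← h1, h2, ← Finset.sum_add_distrib, pow_succ, ← ih, Finset.sum_mul]
    refine Finset.sum_congr rfl fun k _ => ?_
    ring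

theorem stirlingSibuyaWeight_nonneg {n : ℕ} {θ : ℝ} (h : StirlingSibuyaAdmissible n θ) {k : ℕ}
    (hk : k ≤ n) : 0 ≤ stirlingSibuyaWeight n θ k := by
  obtain ⟨-, h0, h⟩ := h
  unfold stirlingSibuyaWeight
  refine div_nonneg (mul_nonneg (Nat.cast_nonneg _) ?_) (pow_nonneg h0.le _)
  rcases h with ⟨m, rfl⟩ | h
  · by_cases hm : m < k
    · exact (Finset.prod_eq_zero (Finset.mem_range.2 hm) (sub_self _)).ge
    · refine Finset.prod_nonneg fun i hi => sub_nonneg.2 ?_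
      have := Finset.mem_range.1 hi
      exact_mod_cast (by omega : i ≤ m)
  · refine Finset.prod_nonneg fun i hi => ?_
    have h1 : i + 1 ≤ n := by have := Finset.mem_range.1 hi; omega
    have h2 : (i : ℝ) + 1 ≤ n := by exact_mod_cast h1
    linarith

theorem isProbabilityMeasure_stirlingSibuya {n : ℕ} {θ : ℝ} (h : StirlingSibuyaAdmissible n θ) :
    IsProbabilityMeasure (stirlingSibuya n θ) := by
  have hsum : ∑ k ∈ Finset.Icc 1 n, stirlingSibuyaWeight n θ k = 1 := by
    have h1 := sum_stirlingSecond_mul_prod n θ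
    have h2 : (Nat.stirlingSecond n 0 : ℝ) = 0 := by
      obtain ⟨m, rfl⟩ : ∃ m, n = m + 1 := ⟨n - 1, by have := h.1; omega⟩
      simp [Nat.stirlingSecond_succ_zero]
    rw [Finset.range_eq_Ico, Finset.sum_eq_sum_Ico_succ_bot (Nat.succ_pos n), h2, zero_mul,
      zero_add] at h1
    have h3 : Finset.Icc 1 n = Finset.Ico (0 + 1) (n + 1) := by ext; simp
    unfold stirlingSibuyaWeight
    rw [← Finset.sum_div, h3, h1]
    exact div_self (pow_ne_zero _ h.2.1.ne')
  constructor
  simp only [stirlingSibuya, Measure.coe_finsetSum, Finset.sum_apply, Measure.smul_apply,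
    measure_univ, smul_eq_mul, mul_one]
  rw [← ENNReal.ofReal_sum_of_nonneg, hsum, ENNReal.ofReal_one]
  intro k hk
  exact stirlingSibuyaWeight_nonneg h (Finset.mem_Icc.1 hk).2

/-- The cut plane `ℂ ∖ (-∞, -1/e]` on which the principal branch of the Lambert function lives. -/
def lambertDomain : Set ℂ :=
  {z : ℂ | z.im ≠ 0 ∨ -(Real.exp (-1)) < z.re}

/-- The range `{a + b i : a > -b cot b, -π < b < π}` (with `0 cot 0 = 1`) of the principal branch
of the Lambert function; note that `b cot b = cos b / sinc b` with `sinc 0 = 1`. -/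
def lambertRange : Set ℂ :=
  {w : ℂ | |w.im| < Real.pi ∧ -(Real.cos w.im / Real.sinc w.im) < w.re}

/-- The principal branch `W₀ : ℂ ∖ (-∞, -1/e] → lambertRange` of the Lambert function, the inverse
of the conformal bijection `w ↦ w e^w` from `lambertRange` onto the cut plane. -/
noncomputable def lambertW0 : ℂ → ℂ :=
  Function.invFunOn (fun w : ℂ => w * Complex.exp w) lambertRange

/-- The argument `ϑ⁻¹ (e^{-z} - 1) e^{-1/ϑ}` at which `W₀` is taken. -/
noncomputable def sibuyaArg (ϑ : ℝ) (z : ℂ) : ℂ :=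
  (ϑ : ℂ)⁻¹ * (Complex.exp (-z) - 1) * Complex.exp (-1 / (ϑ : ℂ))

/-- `L₃(z; ϑ) = 1/ϑ + W₀(ϑ⁻¹ (e^{-z} - 1) e^{-1/ϑ})`. -/
noncomputable def sibuyaL (ϑ : ℝ) (z : ℂ) : ℂ :=
  1 / (ϑ : ℂ) + lambertW0 (sibuyaArg ϑ z)

/-- `φ₃(z; ϑ) = (ϑ - 1) log ϑ - 1 + (ϑ - 1) log L₃(z; ϑ) + ϑ (z + L₃(z; ϑ))`. -/
noncomputable def sibuyaPhi (ϑ : ℝ) (z : ℂ) : ℂ :=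
  ((ϑ : ℂ) - 1) * (Real.log ϑ : ℂ) - 1 + ((ϑ : ℂ) - 1) * Complex.log (sibuyaL ϑ z)
    + (ϑ : ℂ) * (z + sibuyaL ϑ z)

/-- The limit function `√(ϑ / (ϑ L₃(z; ϑ) + ϑ - 1))`, with the principal square root. -/
noncomputable def sibuyaPsi (ϑ : ℝ) (z : ℂ) : ℂ :=
  ((ϑ : ℂ) / ((ϑ : ℂ) * sibuyaL ϑ z + (ϑ : ℂ) - 1)) ^ (1 / 2 : ℂ)

/-- The normalized Laplace transform `E e^{zX} / e^{w φ(z)}`, where `X` has law `μ`. -/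
noncomputable def normalizedLaplace (μ : Measure ℝ) (w : ℝ) (φ : ℂ → ℂ) (z : ℂ) : ℂ :=
  complexMGF id μ z / Complex.exp ((w : ℂ) * φ z)

/-- Mod-`φ` convergence of real random variables `X n` with laws `μ n`, where `n` runs through
the index set `S` and tends to infinity. The parameters are the strip `a < Re z < b` on which the
Laplace transforms exist, the speed `w`, the domain `D` and the analytic functions `φ` and `Ψ`. -/
structure IsModPhiConvergent (S : Set ℕ) (μ : ℕ → Measure ℝ) (a b : EReal) (w : ℕ → ℝ)
    (D : Set ℂ) (φ Ψ : ℂ → ℂ) : Prop where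
  isProbabilityMeasure : ∀ n ∈ S, IsProbabilityMeasure (μ n)
  strip_nonempty : a < b
  laplace_exists : ∀ n ∈ S, ∀ t : ℝ, a < t → (t : EReal) < b → t ∈ integrableExpSet id (μ n)
  speed_pos : ∀ n ∈ S, 0 < w n
  speed_tendsto : Tendsto w (atTop ⊓ 𝓟 S) atTop
  isOpen : IsOpen D
  isConnected : IsConnected D
  subset_strip : ∀ z ∈ D, a < (z.re : EReal) ∧ (z.re : EReal) < b
  interval_subset : ∀ t : ℝ, a < t → (t : EReal) < b → (t : ℂ) ∈ D
  phi_analytic : AnalyticOnNhd ℂ φ D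
  phi_real : ∀ t : ℝ, a < t → (t : EReal) < b → (φ t).im = 0
  phi_strictConvex : StrictConvexOn ℝ {t : ℝ | a < t ∧ (t : EReal) < b} fun t => (φ t).re
  psi_analytic : AnalyticOnNhd ℂ Ψ D
  psi_ne_zero : ∀ t : ℝ, (t : ℂ) ∈ D → Ψ t ≠ 0
  tendsto_uniformly : ∀ K ⊆ D, IsCompact K →
    TendstoUniformlyOn (fun n => normalizedLaplace (μ n) (w n) φ) Ψ (atTop ⊓ 𝓟 S) K

/-! The proof is the saddle point method with uniform error control. Write `F_z(y) = 1 + e^z (e^y -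
1)`. The numerators of the Laplace transform are generated by a power of `F_z`: `∑ S(n,k)
θ(θ-1)⋯(θ-k+1) e^{kz}` is the `n`-th derivative of `F_z(y)^θ` at `y = 0`. With `θ = ϑn`, Cauchy's
formula gives an integral of `(F_z(y)^ϑ / y)^n`. The saddle equation `ϑ y F_z'(y) = F_z(y)` reads
`(ϑy - 1) e^y = e^{-z} - 1`, which the Lambert function solves by `y = L₃(z)`.

At the saddle `F_z(L₃) = ϑ L₃ e^{z + L₃}`, so `F_z(L₃)^{ϑn} / L₃^n` equals `ϑ^n e^n e^{nφ₃(z)}`. On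
`y = L₃ e^{iw}` the exponent vanishes to first order at `w = 0` and has second derivative `-(ϑL₃ + ϑ
- 1)/ϑ = -1/Ψ₃²`. Laplace's method therefore yields `√(2π/n) Ψ₃` with error `O(n^{-3/2})`, because
the cubic Taylor term is odd (`laplace_uniform`). Stirling's formula with relative error `O(1/n)`
absorbs the factorial (`factorial_stirling_bounds`).

Away from the saddle the integrand must be exponentially small. For real `z = t`, positivity of the
Taylor coefficients of `e^y - 1` makes `|F_t|` on the circle `|y| = r` strictly maximal at `y = r`.
If `ϑn` is an integer, the power is a polynomial in `F_t` and the circle suffices. Otherwise `F_t`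
may have a zero `-δ` in `[-r, 0)`, from which a branch cut starts. For `ϑ ≥ 1` the contour then
follows the cut on both sides to a radius slightly below `δ`, and the integrand stays small there
(`integrandRatio_lt_one_of_neg_axis`, `IsSaddle.exists_contour`). For `ϑ < 1` only finitely many
admissible `n` have `ϑn` non-integral, and continuity handles these.

All conditions used are open in `z`, so each real `t` has a complex neighbourhood with one constant
(`IsSaddle.local_asymptotics`). The domain is the union of such balls, and compactness gives the
rate. Convexity follows from `φ₃' = (1 - e^{-r})/r`, where `r = L₃(t)` decreases in `t`. -/

/-! ### The principal branch of the Lambert function -/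

/-- For `w = a + bi`, `Im (w e^w) = e^a (a sin b + b cos b)`, and `a > -b cot b` is the positivity
of the bracket when `0 < b < π`. -/
theorem im_mul_exp_pos_of_mem_lambertRange {w : ℂ} (hw : w ∈ lambertRange) (h : 0 < w.im) :
    0 < (w * Complex.exp w).im := by
  obtain ⟨h1, h2⟩ := hw
  have hpi : w.im < Real.pi := (abs_lt.1 h1).2
  have hs : 0 < Real.sin w.im := Real.sin_pos_of_pos_of_lt_pi h hpi
  rw [Real.sinc_of_ne_zero h.ne', div_div_eq_mul_div, neg_lt, ← sub_pos] at h2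
  have h3 : 0 < w.re * Real.sin w.im + w.im * Real.cos w.im := by
    have := mul_pos h2 hs
    rw [sub_mul, div_mul_cancel₀ _ hs.ne'] at this
    linarith
  rw [Complex.mul_im, Complex.exp_re, Complex.exp_im]
  have := mul_pos (Real.exp_pos w.re) h3
  linarith

theorem conj_mem_lambertRange {w : ℂ} (hw : w ∈ lambertRange) :
    (starRingEnd ℂ) w ∈ lambertRange := by
  obtain ⟨h1, h2⟩ := hw
  exact ⟨by simpa using h1, by simpa [Real.sinc_neg] using h2⟩

theorem ofReal_mem_lambertRange {a : ℝ} (ha : -1 < a) : (a : ℂ) ∈ lambertRange :=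
  ⟨by simpa using Real.pi_pos, by simpa using ha⟩

theorem neg_one_lt_re_of_mem_lambertRange {w : ℂ} (hw : w ∈ lambertRange) (h : w.im = 0) :
    -1 < w.re := by
  simpa [h] using hw.2

/-- The derivative `1/w + 1` has negative imaginary part on the convex upper half plane. Integrated
along the segment from `v` to `w`, it makes the imaginary part of the difference quotient nonzero.
-/
theorem log_add_self_injOn : Set.InjOn (fun w : ℂ => Complex.log w + w) {w : ℂ | 0 < w.im} := by
  intro w hw v hv h
  by_contra hne
  have hd : w - v ≠ 0 := sub_ne_zero.2 hne
  set γ : ℝ → ℂ := fun s => v + (s : ℂ) * (w - v) with hγ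
  have him : ∀ s ∈ Set.Icc (0 : ℝ) 1, 0 < (γ s).im := by
    intro s hs
    have : (γ s).im = (1 - s) * v.im + s * w.im := by simp [hγ]; ring
    rw [this]
    have hv' : 0 < v.im := hv
    have hw' : 0 < w.im := hw
    rcases hs.1.eq_or_lt with h0 | h0
    · simpa [← h0] using hv'
    · have := mul_pos h0 hw'
      have := mul_nonneg (sub_nonneg.2 hs.2) hv'.le
      linarith
  set g : ℝ → ℝ := fun s => ((Complex.log (γ s) + γ s) / (w - v)).im with hg
  have hder : ∀ s ∈ Set.Icc (0 : ℝ) 1, HasDerivAt g (1 / γ s + 1).im s := by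
    intro s hs
    have hγ' : HasDerivAt γ (w - v) s := by
      have := ((Complex.ofRealCLM.hasDerivAt (x := s)).mul_const (w - v)).const_add v
      simpa [hγ] using this
    have hsl : γ s ∈ Complex.slitPlane := Or.inr (him s hs).ne'
    have h1 := ((hγ'.clog_real hsl).add hγ').div_const (w - v)
    have h2 := Complex.imCLM.hasFDerivAt.comp_hasDerivAt s h1
    refine h2.congr_deriv ?_
    have : ((w - v) / γ s + (w - v)) / (w - v) = 1 / γ s + 1 := by
      field_simp
    rw [this]; rfl
  have hanti : StrictAntiOn g (Set.Icc 0 1) := by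
    refine strictAntiOn_of_deriv_neg (convex_Icc 0 1)
      (fun s hs => (hder s hs).continuousAt.continuousWithinAt) fun s hs => ?_
    rw [interior_Icc] at hs
    have hs' := Set.Ioo_subset_Icc_self hs
    rw [(hder s hs').deriv]
    have hp := him s hs'
    have : 0 < Complex.normSq (γ s) := Complex.normSq_pos.2 fun h0 => by simp [h0] at hp
    simp only [one_div, Complex.add_im, Complex.inv_im, Complex.one_im, add_zero]
    exact div_neg_of_neg_of_pos (by linarith) this
  have h01 := hanti (Set.left_mem_Icc.2 zero_le_one) (Set.right_mem_Icc.2 zero_le_one) zero_lt_one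
  have e0 : γ 0 = v := by simp [hγ]
  have e1 : γ 1 = w := by simp [hγ]
  simp only [hg, e0, e1] at h01
  rw [show Complex.log w + w = Complex.log v + v from h] at h01
  exact lt_irrefl _ h01

/-- The imaginary part is `arg w + Im w`, which lies in `(0, 2π)`, and its sine has the sign of `Im
(w e^w) > 0`. This makes `log w + w` the principal logarithm of `w e^w`, so that injectivity of `w
e^w` reduces to `log_add_self_injOn`. -/
theorem log_add_self_im_mem {w : ℂ} (hw : w ∈ lambertRange) (h : 0 < w.im) :
    0 < (Complex.log w + w).im ∧ (Complex.log w + w).im < Real.pi := by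
  have h0 : w ≠ 0 := fun h0 => by simp [h0] at h
  have h1 : Complex.exp (Complex.log w + w) = w * Complex.exp w := by
    rw [Complex.exp_add, Complex.exp_log h0]
  have h2 := im_mul_exp_pos_of_mem_lambertRange hw h
  rw [← h1, Complex.exp_im] at h2
  have h3 : 0 < Real.sin (Complex.log w + w).im := pos_of_mul_pos_right h2 (Real.exp_pos _).le
  have ha : 0 ≤ w.arg := Complex.arg_nonneg_iff.2 h.le
  have ha' : w.arg ≤ Real.pi := Complex.arg_le_pi w
  have hb : w.im < Real.pi := (abs_lt.1 hw.1).2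
  have hi : (Complex.log w + w).im = w.arg + w.im := by simp [Complex.log_im]
  rw [hi] at h3 ⊢
  refine ⟨by linarith, ?_⟩
  by_contra hc
  push Not at hc
  have h4 := Real.sin_nonneg_of_nonneg_of_le_pi (sub_nonneg.2 hc)
    (by linarith : w.arg + w.im - Real.pi ≤ Real.pi)
  rw [Real.sin_sub_pi] at h4
  linarith

theorem mul_exp_strictMonoOn : StrictMonoOn (fun x : ℝ => x * Real.exp x) (Set.Ioi (-1)) := by
  have hd : ∀ x : ℝ, HasDerivAt (fun x : ℝ => x * Real.exp x) ((1 + x) * Real.exp x) x := by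
    intro x
    refine ((hasDerivAt_id x).mul (Real.hasDerivAt_exp x)).congr_deriv ?_
    simp only [id]; ring
  refine strictMonoOn_of_deriv_pos (convex_Ioi _)
    (fun x _ => (hd x).continuousAt.continuousWithinAt) fun x hx => ?_
  rw [interior_Ioi] at hx
  rw [(hd x).deriv]
  have : -1 < x := hx
  exact mul_pos (by linarith) (Real.exp_pos _)

/-- The map preserves the sign of the imaginary part, so the upper half, the lower half and the real
line can be treated separately; conjugation exchanges the two halves. -/
theorem mul_exp_injOn_lambertRange :
    Set.InjOn (fun w : ℂ => w * Complex.exp w) lambertRange := by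
  have key : ∀ w ∈ lambertRange, ∀ v ∈ lambertRange, 0 < w.im → 0 < v.im →
      w * Complex.exp w = v * Complex.exp v → w = v := by
    intro w hw v hv h1 h2 h
    have h3 := log_add_self_im_mem hw h1
    have h4 := log_add_self_im_mem hv h2
    have hw0 : w ≠ 0 := fun h0 => by simp [h0] at h1
    have hv0 : v ≠ 0 := fun h0 => by simp [h0] at h2
    refine log_add_self_injOn h1 h2 (Complex.exp_inj_of_neg_pi_lt_of_le_pi
      (by linarith [Real.pi_pos]) h3.2.le (by linarith [Real.pi_pos]) h4.2.le ?_)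
    rw [Complex.exp_add, Complex.exp_add, Complex.exp_log hw0, Complex.exp_log hv0, h]
  have conj_eq : ∀ w : ℂ, (starRingEnd ℂ) w * Complex.exp ((starRingEnd ℂ) w) =
      (starRingEnd ℂ) (w * Complex.exp w) := by
    intro w; rw [map_mul, Complex.exp_conj]
  have hneg : ∀ w ∈ lambertRange, w.im < 0 → (w * Complex.exp w).im < 0 := by
    intro w hw h
    have := im_mul_exp_pos_of_mem_lambertRange (conj_mem_lambertRange hw) (by simpa using h)
    rw [conj_eq, Complex.conj_im] at this
    linarith
  have hreal : ∀ w : ℂ, w.im = 0 → w * Complex.exp w = ((w.re * Real.exp w.re : ℝ) : ℂ) := by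
    intro w h
    have : w = (w.re : ℂ) := Complex.ext rfl (by simpa using h)
    conv_lhs => rw [this]
    push_cast; rfl
  intro w hw v hv h
  have hE : w * Complex.exp w = v * Complex.exp v := h
  have hp := fun u hu => im_mul_exp_pos_of_mem_lambertRange (w := u) hu
  have h0 : ∀ u : ℂ, u.im = 0 → (u * Complex.exp u).im = 0 := fun u hu => by
    rw [hreal u hu, Complex.ofReal_im]
  rcases lt_trichotomy w.im 0 with hw1 | hw1 | hw1 <;>
    rcases lt_trichotomy v.im 0 with hv1 | hv1 | hv1
  · have := key _ (conj_mem_lambertRange hw) _ (conj_mem_lambertRange hv) (by simpa using hw1)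
      (by simpa using hv1) (by rw [conj_eq, conj_eq, hE])
    exact (starRingEnd ℂ).injective this
  · have a := hneg w hw hw1; have b := h0 v hv1; rw [hE] at a; linarith
  · have a := hneg w hw hw1; have b := hp v hv hv1; rw [hE] at a; linarith
  · have a := hneg v hv hv1; have b := h0 w hw1; rw [hE] at b; linarith
  · rw [hreal w hw1, hreal v hv1, Complex.ofReal_inj] at hE
    have := mul_exp_strictMonoOn.injOn (neg_one_lt_re_of_mem_lambertRange hw hw1)
      (neg_one_lt_re_of_mem_lambertRange hv hv1) hE
    exact Complex.ext this (hw1.trans hv1.symm)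
  · have a := hp v hv hv1; have b := h0 w hw1; rw [hE] at b; linarith
  · have a := hneg v hv hv1; have b := hp w hw hw1; rw [hE] at b; linarith
  · have a := hp w hw hw1; have b := h0 v hv1; rw [hE] at a; linarith
  · exact key w hw v hv hw1 hv1 hE

theorem lambertW0_mul_exp {w : ℂ} (hw : w ∈ lambertRange) :
    lambertW0 (w * Complex.exp w) = w :=
  mul_exp_injOn_lambertRange.leftInvOn_invFunOn hw

theorem lambertRange_mem_nhds_ofReal {a : ℝ} (ha : -1 < a) : lambertRange ∈ 𝓝 (a : ℂ) := by
  have h1 : ContinuousAt (fun w : ℂ => |w.im|) (a : ℂ) := by fun_prop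
  have h2 : ContinuousAt (fun w : ℂ => -(Real.cos w.im / Real.sinc w.im)) (a : ℂ) := by
    refine ContinuousAt.neg (ContinuousAt.div (by fun_prop) ?_ (by simp))
    exact (Real.continuous_sinc.comp Complex.continuous_im).continuousAt
  have h3 : ContinuousAt Complex.re (a : ℂ) := Complex.continuous_re.continuousAt
  have e1 := h1.eventually_lt (continuousAt_const (y := Real.pi)) (by simpa using Real.pi_pos)
  have e2 := h2.eventually_lt h3 (by simpa using ha)
  filter_upwards [e1, e2] with w hw1 hw2 using ⟨hw1, hw2⟩

/-- The derivative `(1 + a) e^a` is nonzero, so a local analytic inverse exists. Near the point its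
values stay in `lambertRange`, and injectivity there identifies it with `lambertW0`. -/
theorem lambertW0_analyticAt {a : ℝ} (ha : -1 < a) :
    AnalyticAt ℂ lambertW0 ((a : ℂ) * Complex.exp a) := by
  set f : ℂ → ℂ := fun w => w * Complex.exp w with hf
  have hfa : AnalyticAt ℂ f (a : ℂ) := by fun_prop
  have hd : deriv f a ≠ 0 := by
    have : HasDerivAt f ((1 + a) * Complex.exp a) (a : ℂ) := by
      refine ((hasDerivAt_id (a : ℂ)).mul (Complex.hasDerivAt_exp a)).congr_deriv ?_
      simp only [id]; ring
    rw [this.deriv]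
    refine mul_ne_zero ?_ (Complex.exp_ne_zero _)
    have : (1 + a : ℝ) ≠ 0 := by linarith
    exact_mod_cast this
  have hs := hfa.hasStrictDerivAt
  have hg := hfa.analyticAt_localInverse hd
  have hr : ∀ᶠ z in 𝓝 (f a), f (hs.localInverse _ _ _ hd z) = z :=
    (hs.hasStrictFDerivAt_equiv hd).eventually_right_inverse
  have hga : hs.localInverse _ _ _ hd (f a) = a :=
    (hs.hasStrictFDerivAt_equiv hd).localInverse_apply_image
  have hm : ∀ᶠ z in 𝓝 (f a), hs.localInverse _ _ _ hd z ∈ lambertRange := by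
    refine hg.continuousAt.eventually_mem ?_
    rw [hga]; exact lambertRange_mem_nhds_ofReal ha
  refine hg.congr ?_
  filter_upwards [hr, hm] with z h1 h2
  conv_rhs => rw [← h1]
  exact (lambertW0_mul_exp h2).symm

theorem lambertW0_mul_exp_lambertW0_eventually {a : ℝ} (ha : -1 < a) :
    ∀ᶠ z in 𝓝 ((a : ℂ) * Complex.exp a), lambertW0 z * Complex.exp (lambertW0 z) = z := by
  have hd : HasStrictDerivAt (fun w : ℂ => w * Complex.exp w) ((1 + a) * Complex.exp a) (a : ℂ) := by
    refine ((hasStrictDerivAt_id (a : ℂ)).mul (Complex.hasStrictDerivAt_exp a)).congr_deriv ?_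
    simp only [id]; ring
  have h0 : (1 + a) * Complex.exp a ≠ 0 := by
    refine mul_ne_zero ?_ (Complex.exp_ne_zero _)
    have : (1 + a : ℝ) ≠ 0 := by linarith
    exact_mod_cast this
  rw [← hd.map_nhds_eq h0, eventually_map]
  filter_upwards [lambertRange_mem_nhds_ofReal ha] with w hw
  rw [lambertW0_mul_exp hw]

theorem ofReal_mul_exp_mem_lambertDomain {a : ℝ} (ha : -1 < a) :
    (a : ℂ) * Complex.exp a ∈ lambertDomain := by
  refine Or.inr ?_
  -- The midpoint of `-1` and `a` gives a strict inequality from the weak bound `-1/e ≤ x e^x`,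
  -- which is `e^u ≥ 1 + u` at `u = -1 - x`.
  have h := mul_exp_strictMonoOn (a := (-1 + a) / 2) (b := a)
    (by simp only [Set.mem_Ioi]; linarith) ha (by linarith)
  have h2 : (a : ℂ) * Complex.exp a = ((a * Real.exp a : ℝ) : ℂ) := by push_cast; rfl
  rw [h2, Complex.ofReal_re]
  refine lt_of_le_of_lt ?_ h
  have h3 := Real.add_one_le_exp (-1 - (-1 + a) / 2)
  have h4 : Real.exp (-1) = Real.exp (-1 - (-1 + a) / 2) * Real.exp ((-1 + a) / 2) := by
    rw [← Real.exp_add]; ring_nf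
  have := mul_le_mul_of_nonneg_right h3 (Real.exp_pos ((-1 + a) / 2)).le
  simp only
  rw [h4]
  nlinarith

theorem isOpen_lambertDomain : IsOpen lambertDomain :=
  (isOpen_ne_fun Complex.continuous_im continuous_const).union
    (isOpen_lt continuous_const Complex.continuous_re)

/-! ### The real saddle point -/

/-- `r` is the real saddle point attached to the real argument `t`. -/
structure IsSaddle (ϑ t r : ℝ) : Prop where
  pos : 0 < r
  pos' : 0 < ϑ * r + ϑ - 1
  eqn : (ϑ * r - 1) * Real.exp r = Real.exp (-t) - 1

theorem exists_isSaddle {ϑ : ℝ} (hϑ : 0 < ϑ) (t : ℝ) : ∃ r, IsSaddle ϑ t r := by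
  set g : ℝ → ℝ := fun r => (ϑ * r - 1) * Real.exp r with hg
  have hc : Continuous g := by fun_prop
  -- The left endpoint is `max 0 (1/ϑ - 1)`, where both positivity conditions become equalities or
  -- weak inequalities. The value there is at most `-1`, strictly below the target, so the root
  -- found lies strictly to the right.
  obtain ⟨r₁, h0, h1, h2⟩ : ∃ r₁ : ℝ, 0 ≤ r₁ ∧ 0 ≤ ϑ * r₁ + ϑ - 1 ∧ g r₁ ≤ -1 := by
    rcases le_total 1 ϑ with h | h
    · exact ⟨0, le_rfl, by linarith, by simp [hg]⟩
    · refine ⟨1 / ϑ - 1, ?_, ?_, ?_⟩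
      · rw [sub_nonneg, le_div_iff₀ hϑ]; linarith
      · have : ϑ * (1 / ϑ - 1) = 1 - ϑ := by field_simp
        rw [this]; linarith
      · have : ϑ * (1 / ϑ - 1) = 1 - ϑ := by field_simp
        simp only [hg]
        rw [this]
        have h3 := Real.add_one_le_exp (1 / ϑ - 1)
        have h4 := mul_le_mul_of_nonneg_left h3 hϑ.le
        have h5 : ϑ * (1 / ϑ - 1 + 1) = 1 := by field_simp; ring
        linarith
  have ht : -1 < Real.exp (-t) - 1 := by linarith [Real.exp_pos (-t)]
  set R : ℝ := r₁ + (Real.exp (-t) + 1) / ϑ with hR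
  have hpos : 0 < (Real.exp (-t) + 1) / ϑ := by positivity
  have hgR : Real.exp (-t) - 1 ≤ g R := by
    have e1 : ϑ * R = ϑ * r₁ + (Real.exp (-t) + 1) := by
      rw [hR]; field_simp
    have e2 : Real.exp (-t) ≤ ϑ * R - 1 := by rw [e1]; nlinarith
    have e3 : 1 ≤ Real.exp R := Real.one_le_exp (by rw [hR]; linarith)
    have e4 := Real.exp_pos (-t)
    have : (ϑ * R - 1) * 1 ≤ g R := mul_le_mul_of_nonneg_left e3 (by linarith)
    linarith
  obtain ⟨r, hr, hr2⟩ := intermediate_value_Icc (by rw [hR]; linarith : r₁ ≤ R) hc.continuousOn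
    ⟨by linarith, hgR⟩
  have hlt : r₁ < r := by
    refine lt_of_le_of_ne hr.1 fun h => ?_
    rw [← h] at hr2; linarith
  have := mul_lt_mul_of_pos_left hlt hϑ
  exact ⟨r, by linarith, by linarith, hr2⟩

namespace IsSaddle

variable {ϑ t r : ℝ}

/-- Places `r - 1/ϑ` on the real part of `lambertRange`; this is what selects the principal branch.
-/
theorem neg_one_lt (h : IsSaddle ϑ t r) (hϑ : 0 < ϑ) : -1 < r - 1 / ϑ := by
  have := h.pos'
  have h2 : r - 1 / ϑ + 1 = (ϑ * r + ϑ - 1) / ϑ := by field_simp; ring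
  have h3 : 0 < (ϑ * r + ϑ - 1) / ϑ := div_pos this hϑ
  linarith

theorem sibuyaArg_eq (h : IsSaddle ϑ t r) (hϑ : 0 < ϑ) :
    sibuyaArg ϑ t = ((r - 1 / ϑ : ℝ) : ℂ) * Complex.exp ((r - 1 / ϑ : ℝ) : ℂ) := by
  have h2 : sibuyaArg ϑ t = ((ϑ⁻¹ * (Real.exp (-t) - 1) * Real.exp (-1 / ϑ) : ℝ) : ℂ) := by
    unfold sibuyaArg; push_cast; rfl
  rw [h2, ← h.eqn, ← Complex.ofReal_exp, ← Complex.ofReal_mul]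
  congr 1
  have : r - 1 / ϑ = r + -1 / ϑ := by ring
  rw [this, Real.exp_add]
  field_simp
  ring

theorem sibuyaArg_mem (h : IsSaddle ϑ t r) (hϑ : 0 < ϑ) : sibuyaArg ϑ t ∈ lambertDomain := by
  rw [h.sibuyaArg_eq hϑ]
  exact ofReal_mul_exp_mem_lambertDomain (h.neg_one_lt hϑ)

theorem sibuyaL_eq (h : IsSaddle ϑ t r) (hϑ : 0 < ϑ) : sibuyaL ϑ t = r := by
  rw [sibuyaL, h.sibuyaArg_eq hϑ, lambertW0_mul_exp (ofReal_mem_lambertRange (h.neg_one_lt hϑ))]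
  push_cast; ring

theorem analyticAt_sibuyaL (h : IsSaddle ϑ t r) (hϑ : 0 < ϑ) : AnalyticAt ℂ (sibuyaL ϑ) t := by
  have h1 : AnalyticAt ℂ (sibuyaArg ϑ) t := by unfold sibuyaArg; fun_prop
  have h2 := lambertW0_analyticAt (h.neg_one_lt hϑ)
  rw [← h.sibuyaArg_eq hϑ] at h2
  exact analyticAt_const.add (h2.comp h1)

/-- The saddle equation persists at complex `z` near `t`, because `W₀` is a right inverse of `w e^w`
near the real argument. -/
theorem sibuyaL_eqn_eventually (h : IsSaddle ϑ t r) (hϑ : 0 < ϑ) :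
    ∀ᶠ z in 𝓝 (t : ℂ),
      (ϑ * sibuyaL ϑ z - 1) * Complex.exp (sibuyaL ϑ z) = Complex.exp (-z) - 1 := by
  have h1 : ContinuousAt (sibuyaArg ϑ) t := by unfold sibuyaArg; fun_prop
  have h2 := lambertW0_mul_exp_lambertW0_eventually (h.neg_one_lt hϑ)
  rw [← h.sibuyaArg_eq hϑ] at h2
  have h0 : (ϑ : ℂ) ≠ 0 := by exact_mod_cast hϑ.ne'
  filter_upwards [h1.eventually h2] with z hz
  have h3 : ϑ * sibuyaL ϑ z - 1 = ϑ * lambertW0 (sibuyaArg ϑ z) := by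
    unfold sibuyaL; field_simp; ring
  rw [h3]
  unfold sibuyaL
  rw [Complex.exp_add]
  have h4 : ϑ * lambertW0 (sibuyaArg ϑ z) *
      (Complex.exp (1 / ϑ) * Complex.exp (lambertW0 (sibuyaArg ϑ z))) =
      ϑ * Complex.exp (1 / ϑ) * (lambertW0 (sibuyaArg ϑ z) *
        Complex.exp (lambertW0 (sibuyaArg ϑ z))) := by ring
  rw [h4, hz]
  unfold sibuyaArg
  have h5 : Complex.exp (1 / ϑ) * Complex.exp (-1 / ϑ) = 1 := by
    rw [← Complex.exp_add, ← add_div]; simp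
  have h6 : (ϑ : ℂ) * (ϑ : ℂ)⁻¹ = 1 := mul_inv_cancel₀ h0
  linear_combination (Complex.exp (-z) - 1) * (h5 * (ϑ : ℂ) * (ϑ : ℂ)⁻¹ + h6)

theorem sibuyaL_mem_slitPlane (h : IsSaddle ϑ t r) (hϑ : 0 < ϑ) :
    sibuyaL ϑ t ∈ Complex.slitPlane := by
  rw [h.sibuyaL_eq hϑ]; exact Complex.ofReal_mem_slitPlane.2 h.pos

theorem psi_mem_slitPlane (h : IsSaddle ϑ t r) (hϑ : 0 < ϑ) :
    (ϑ : ℂ) / ((ϑ : ℂ) * sibuyaL ϑ t + (ϑ : ℂ) - 1) ∈ Complex.slitPlane := by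
  rw [h.sibuyaL_eq hϑ]
  have : (ϑ : ℂ) / ((ϑ : ℂ) * r + (ϑ : ℂ) - 1) = ((ϑ / (ϑ * r + ϑ - 1) : ℝ) : ℂ) := by
    push_cast; rfl
  rw [this]
  exact Complex.ofReal_mem_slitPlane.2 (div_pos hϑ h.pos')

theorem denominator_ne_zero (h : IsSaddle ϑ t r) (hϑ : 0 < ϑ) :
    (ϑ : ℂ) * sibuyaL ϑ t + (ϑ : ℂ) - 1 ≠ 0 := fun h0 => by
  have := h.psi_mem_slitPlane hϑ
  rw [h0, div_zero] at this
  exact Complex.zero_notMem_slitPlane this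

theorem analyticAt_sibuyaPhi (h : IsSaddle ϑ t r) (hϑ : 0 < ϑ) :
    AnalyticAt ℂ (sibuyaPhi ϑ) t := by
  have h1 := h.analyticAt_sibuyaL hϑ
  have h2 := h1.clog (h.sibuyaL_mem_slitPlane hϑ)
  unfold sibuyaPhi
  fun_prop

theorem analyticAt_quotient (h : IsSaddle ϑ t r) (hϑ : 0 < ϑ) :
    AnalyticAt ℂ (fun z => (ϑ : ℂ) / ((ϑ : ℂ) * sibuyaL ϑ z + (ϑ : ℂ) - 1)) t := by
  have h1 := h.analyticAt_sibuyaL hϑ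
  exact AnalyticAt.div analyticAt_const (by fun_prop) (h.denominator_ne_zero hϑ)

theorem analyticAt_sibuyaPsi (h : IsSaddle ϑ t r) (hϑ : 0 < ϑ) :
    AnalyticAt ℂ (sibuyaPsi ϑ) t :=
  (h.analyticAt_quotient hϑ).cpow analyticAt_const (h.psi_mem_slitPlane hϑ)

theorem sibuyaPsi_ne_zero (h : IsSaddle ϑ t r) (hϑ : 0 < ϑ) : sibuyaPsi ϑ t ≠ 0 := by
  unfold sibuyaPsi
  rw [Complex.cpow_ne_zero_iff]
  exact Or.inl (Complex.slitPlane_ne_zero (h.psi_mem_slitPlane hϑ))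

theorem sibuyaPhi_im (h : IsSaddle ϑ t r) (hϑ : 0 < ϑ) : (sibuyaPhi ϑ t).im = 0 := by
  unfold sibuyaPhi
  rw [h.sibuyaL_eq hϑ, ← Complex.ofReal_log h.pos.le]
  simp

/-- Differentiating the saddle equation gives `(ϑL + ϑ - 1) L' = -e^{-z-L}`, and `φ₃' = ϑ + (ϑL + ϑ
- 1) L'/L`. Eliminating `e^{-z}` by the saddle equation leaves `(1 - e^{-L})/L`. -/
theorem hasDerivAt_sibuyaPhi (h : IsSaddle ϑ t r) (hϑ : 0 < ϑ) :
    HasDerivAt (sibuyaPhi ϑ) (((1 - Real.exp (-r)) / r : ℝ) : ℂ) t := by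
  have hL := (h.analyticAt_sibuyaL hϑ).differentiableAt.hasDerivAt
  set L' := deriv (sibuyaL ϑ) t with hL'
  have hr := h.sibuyaL_eq hϑ
  have h1 : HasDerivAt (fun z => (ϑ * sibuyaL ϑ z - 1) * Complex.exp (sibuyaL ϑ z))
      (ϑ * L' * Complex.exp r + (ϑ * r - 1) * (Complex.exp r * L')) t := by
    have := ((hL.const_mul (ϑ : ℂ)).sub_const 1).mul hL.cexp
    rwa [hr] at this
  have h2 : HasDerivAt (fun z : ℂ => Complex.exp (-z) - 1) (Complex.exp (-t) * -1) t :=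
    ((hasDerivAt_id (t : ℂ)).neg.cexp).sub_const 1
  have h3 := (h1.congr_of_eventuallyEq
    ((h.sibuyaL_eqn_eventually hϑ).mono fun z hz => hz.symm)).unique h2
  have h4 := (h.sibuyaL_eqn_eventually hϑ).self_of_nhds
  rw [hr] at h4
  have h5 := ((hL.clog (h.sibuyaL_mem_slitPlane hϑ)).const_mul ((ϑ : ℂ) - 1)).const_add
    (((ϑ : ℂ) - 1) * (Real.log ϑ : ℂ) - 1)
  have h6 := ((hasDerivAt_id (t : ℂ)).add hL).const_mul (ϑ : ℂ)
  refine (h5.add h6).congr_deriv ?_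
  rw [hr]
  have hr0 : (r : ℂ) ≠ 0 := by exact_mod_cast h.pos.ne'
  have he : Complex.exp (-r) * Complex.exp r = 1 := by rw [← Complex.exp_add]; simp
  have he0 := Complex.exp_ne_zero (r : ℂ)
  push_cast
  rw [Complex.exp_neg (r : ℂ)]
  field_simp
  linear_combination h3 + h4

end IsSaddle

/-! ### Strict convexity on the real line -/

theorem one_sub_exp_neg_div_strictAntiOn :
    StrictAntiOn (fun r : ℝ => (1 - Real.exp (-r)) / r) (Set.Ioi 0) := by
  have hd : ∀ r : ℝ, 0 < r → HasDerivAt (fun r : ℝ => (1 - Real.exp (-r)) / r)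
      ((Real.exp (-r) * r - (1 - Real.exp (-r)) * 1) / r ^ 2) r := by
    intro r hr
    have h1 : HasDerivAt (fun r : ℝ => 1 - Real.exp (-r)) (Real.exp (-r)) r := by
      have := (hasDerivAt_neg r).exp.const_sub 1
      simpa using this
    exact h1.div (hasDerivAt_id r) hr.ne'
  refine strictAntiOn_of_deriv_neg (convex_Ioi 0)
    (fun r hr => (hd r hr).continuousAt.continuousWithinAt) fun r hr => ?_
  rw [interior_Ioi] at hr
  have hr' : 0 < r := hr
  rw [(hd r hr).deriv]
  refine div_neg_of_neg_of_pos ?_ (by positivity)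
  have h1 := Real.add_one_lt_exp hr'.ne'
  have h2 := mul_lt_mul_of_pos_left h1 (Real.exp_pos (-r))
  rw [← Real.exp_add, neg_add_cancel, Real.exp_zero] at h2
  linarith

theorem IsSaddle.lt_of_lt {ϑ t t' r r' : ℝ} (hϑ : 0 < ϑ) (h : IsSaddle ϑ t r)
    (h' : IsSaddle ϑ t' r') (ht : t < t') : r' < r := by
  -- Shifting by `1/ϑ` turns the left side of the saddle equation into a positive multiple of `x
  -- e^x` with `x > -1`, which is strictly increasing.
  have key : ∀ s : ℝ, (ϑ * s - 1) * Real.exp s =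
      ϑ * Real.exp (1 / ϑ) * ((s - 1 / ϑ) * Real.exp (s - 1 / ϑ)) := by
    intro s
    have : Real.exp s = Real.exp (1 / ϑ) * Real.exp (s - 1 / ϑ) := by
      rw [← Real.exp_add]; ring_nf
    rw [this]; field_simp
  by_contra hc
  push Not at hc
  have h1 := mul_exp_strictMonoOn.monotoneOn (h.neg_one_lt hϑ) (h'.neg_one_lt hϑ)
    (sub_le_sub_right hc _)
  have h2 := mul_le_mul_of_nonneg_left h1 (by positivity : 0 ≤ ϑ * Real.exp (1 / ϑ))
  rw [← key, ← key, h.eqn, h'.eqn] at h2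
  have := Real.exp_lt_exp.2 (neg_lt_neg ht)
  linarith

theorem strictConvexOn_sibuyaPhi_re {ϑ : ℝ} (hϑ : 0 < ϑ) :
    StrictConvexOn ℝ Set.univ fun t : ℝ => (sibuyaPhi ϑ t).re := by
  choose ρ hρ using fun t => exists_isSaddle hϑ t
  have hd : ∀ t : ℝ, HasDerivAt (fun t : ℝ => (sibuyaPhi ϑ t).re)
      ((1 - Real.exp (-ρ t)) / ρ t) t := fun t => by
    have := ((hρ t).hasDerivAt_sibuyaPhi hϑ).real_of_complex
    rwa [Complex.ofReal_re] at this
  refine StrictMono.strictConvexOn_univ_of_deriv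
    (continuous_iff_continuousAt.2 fun t => (hd t).continuousAt) fun t t' htt => ?_
  rw [(hd t).deriv, (hd t').deriv]
  exact one_sub_exp_neg_div_strictAntiOn (hρ t').pos (hρ t).pos ((hρ t).lt_of_lt hϑ (hρ t') htt)

/-! ### Laplace's method with uniform error -/

/-- Cauchy's estimates on the circle of radius `R/2` bound the tail by a geometric series of ratio
at most `1/2`. The bound depends on `h` only through `R` and `M`, as uniformity in `z` requires. -/
theorem norm_sub_taylor_le {h : ℂ → ℂ} {R M : ℝ} (hR : 0 < R)
    (hd : DifferentiableOn ℂ h (Metric.ball 0 R)) (hM : ∀ z ∈ Metric.ball (0 : ℂ) R, ‖h z‖ ≤ M)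
    (N : ℕ) {z : ℂ} (hz : ‖z‖ ≤ R / 4) :
    ‖h z - ∑ k ∈ Finset.range N, z ^ k * ((k.factorial : ℂ)⁻¹ * iteratedDeriv k h 0)‖ ≤
      2 * M * (2 / R) ^ N * ‖z‖ ^ N := by
  have hM0 : 0 ≤ M := (norm_nonneg _).trans (hM 0 (Metric.mem_ball_self hR))
  have hsub : Metric.closedBall (0 : ℂ) (R / 2) ⊆ Metric.ball 0 R :=
    Metric.closedBall_subset_ball (by linarith)
  have hD : DiffContOnCl ℂ h (Metric.ball 0 (R / 2)) :=
    DifferentiableOn.diffContOnCl (by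
      rw [closure_ball _ (by linarith : R / 2 ≠ 0)]; exact hd.mono hsub)
  have hcoef : ∀ k : ℕ, ‖z ^ k * ((k.factorial : ℂ)⁻¹ * iteratedDeriv k h 0)‖ ≤
      M * (2 / R * ‖z‖) ^ k := by
    intro k
    have h1 := Complex.norm_iteratedDeriv_le_of_forall_mem_sphere_norm_le k (by linarith : 0 < R / 2)
      hD (fun w hw => hM w (hsub (Metric.sphere_subset_closedBall hw)))
    have hf : (0 : ℝ) < k.factorial := by exact_mod_cast k.factorial_pos
    rw [norm_mul, norm_mul, norm_inv, norm_pow, Complex.norm_natCast]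
    calc ‖z‖ ^ k * ((k.factorial : ℝ)⁻¹ * ‖iteratedDeriv k h 0‖)
        ≤ ‖z‖ ^ k * ((k.factorial : ℝ)⁻¹ * (k.factorial * M / (R / 2) ^ k)) := by gcongr
      _ = M * (2 / R * ‖z‖) ^ k := by
        rw [mul_pow, div_pow, div_pow]; field_simp
  have hq : 2 / R * ‖z‖ ≤ 1 / 2 := by
    rw [div_mul_eq_mul_div, div_le_iff₀ hR]; linarith
  have hq0 : 0 ≤ 2 / R * ‖z‖ := by positivity
  have hzb : z ∈ Metric.ball (0 : ℂ) R := by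
    rw [mem_ball_zero_iff]; linarith
  have hs := Complex.hasSum_taylorSeries_on_ball hd hzb
  have hs' : HasSum (fun k : ℕ => z ^ k * ((k.factorial : ℂ)⁻¹ * iteratedDeriv k h 0)) (h z) := by
    refine (congrArg (fun f => HasSum f (h z)) (funext fun k => ?_)).mpr hs
    simp only [sub_zero, smul_eq_mul]; ring
  have ht := (hasSum_nat_add_iff' N).2 hs'
  have hg : HasSum (fun k : ℕ => M * (2 / R * ‖z‖) ^ (k + N))
      (M * (2 / R * ‖z‖) ^ N * (1 - 2 / R * ‖z‖)⁻¹) := by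
    have := (hasSum_geometric_of_lt_one hq0 (by linarith)).mul_left (M * (2 / R * ‖z‖) ^ N)
    refine (congrArg (fun f => HasSum f (M * (2 / R * ‖z‖) ^ N * (1 - 2 / R * ‖z‖)⁻¹))
      (funext fun k => ?_)).mpr this
    simp only [pow_add]; ring
  refine (ht.norm_le_of_bounded hg fun k => hcoef (k + N)).trans ?_
  have h2 : (1 - 2 / R * ‖z‖)⁻¹ ≤ 2 := by
    rw [inv_le_comm₀ (by linarith) (by norm_num)]; linarith
  calc M * (2 / R * ‖z‖) ^ N * (1 - 2 / R * ‖z‖)⁻¹ ≤ M * (2 / R * ‖z‖) ^ N * 2 := by gcongr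
    _ = _ := by rw [mul_pow]; ring

theorem ofReal_mul_cpow {r : ℝ} (hr : 0 < r) {z : ℂ} (hz : z ≠ 0) (w : ℂ) :
    ((r : ℂ) * z) ^ w = (r : ℂ) ^ w * z ^ w := by
  have hr' : (r : ℂ) ≠ 0 := by exact_mod_cast hr.ne'
  rw [Complex.cpow_def_of_ne_zero (mul_ne_zero hr' hz), Complex.cpow_def_of_ne_zero hr',
    Complex.cpow_def_of_ne_zero hz, Complex.log_ofReal_mul hr hz, ← Complex.exp_add,
    Complex.ofReal_log hr.le, add_mul]

theorem integral_exp_neg_mul_sq_div_two {s : ℂ} (hs : 0 < s.re) {n : ℝ} (hn : 0 < n) :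
    ∫ x : ℝ, Complex.exp (n * (-s * x ^ 2 / 2)) =
      (√(2 * Real.pi / n) : ℝ) * (1 / s) ^ (1 / 2 : ℂ) := by
  have hs0 : s ≠ 0 := fun h => by simp [h] at hs
  have hb : 0 < ((n : ℂ) * s / 2).re := by
    have : ((n : ℂ) * s / 2) = ((n / 2 : ℝ) : ℂ) * s := by push_cast; ring
    rw [this, Complex.re_ofReal_mul]; positivity
  have h1 := integral_gaussian_complex hb
  have h2 : (Real.pi : ℂ) / ((n : ℂ) * s / 2) = ((2 * Real.pi / n : ℝ) : ℂ) * (1 / s) := by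
    have : (n : ℂ) ≠ 0 := by exact_mod_cast hn.ne'
    push_cast; field_simp
  rw [h2, ofReal_mul_cpow (by positivity) (one_div_ne_zero hs0)] at h1
  have h3 : ((2 * Real.pi / n : ℝ) : ℂ) ^ (1 / 2 : ℂ) = (√(2 * Real.pi / n) : ℝ) := by
    rw [Real.sqrt_eq_rpow, Complex.ofReal_cpow (by positivity)]; norm_num
  rw [h3] at h1
  rw [← h1]
  congr 1 with x
  congr 1; ring

/-- Used with `A` the Gaussian exponent, `E` the whole Taylor remainder and `T` its cubic term: the
error is then quadratic in `E` plus quartic in the variable. -/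
theorem norm_exp_add_sub_le (A E T : ℂ) :
    ‖Complex.exp (A + E) - Complex.exp A * (1 + T)‖ ≤
      Real.exp (A.re + ‖E‖) * (‖E‖ ^ 2 + ‖E - T‖) := by
  have h1 := Complex.norm_exp_sub_sum_le_norm_mul_exp E 2
  simp only [Finset.sum_range_succ, Finset.sum_range_zero, pow_zero, Nat.factorial, pow_one,
    Nat.cast_one, div_one, zero_add, mul_one] at h1
  have h2 : Complex.exp (A + E) - Complex.exp A * (1 + T) =
      Complex.exp A * ((Complex.exp E - (1 + E)) + (E - T)) := by
    rw [Complex.exp_add]; ring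
  rw [h2, norm_mul, Complex.norm_exp, Real.exp_add, mul_assoc]
  gcongr
  have h3 : 1 ≤ Real.exp ‖E‖ := Real.one_le_exp (norm_nonneg _)
  calc ‖(Complex.exp E - (1 + E)) + (E - T)‖ ≤ ‖E‖ ^ 2 * Real.exp ‖E‖ + ‖E - T‖ :=
        (norm_add_le _ _).trans (add_le_add_left h1 _)
    _ ≤ Real.exp ‖E‖ * (‖E‖ ^ 2 + ‖E - T‖) := by
        have := mul_le_mul_of_nonneg_right h3 (norm_nonneg (E - T))
        nlinarith

/-- With `y = ncx²/8`, the polynomial factors are multiples of `y³/n` and `y²/n`. The bound `y^k ≤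
k! e^y` costs half of the Gaussian decay and leaves the factor `1/n`. -/
theorem laplace_pointwise_bound {C₃ C₄ c : ℝ} (hC₄ : 0 ≤ C₄) (hc : 0 < c)
    {n : ℝ} (hn : 0 < n) (x : ℝ) :
    Real.exp (-(n * c * x ^ 2 / 4)) * ((n * (C₃ * |x| ^ 3)) ^ 2 + n * (C₄ * |x| ^ 4)) ≤
      (C₃ ^ 2 * (8 / c) ^ 3 * 6 + C₄ * (8 / c) ^ 2 * 2) / n * Real.exp (-(n * c / 8) * x ^ 2) := by
  set y := n * c * x ^ 2 / 8 with hy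
  have hy0 : 0 ≤ y := by positivity
  have h3 := Real.pow_div_factorial_le_exp y hy0 3
  have h2 := Real.pow_div_factorial_le_exp y hy0 2
  norm_num [Nat.factorial] at h3 h2
  have h3' : y ^ 3 ≤ 6 * Real.exp y := by linarith
  have h2' : y ^ 2 ≤ 2 * Real.exp y := by linarith
  have hx2 : |x| ^ 2 = x ^ 2 := sq_abs x
  have e1 : (n * (C₃ * |x| ^ 3)) ^ 2 = C₃ ^ 2 * (8 / c) ^ 3 / n * y ^ 3 := by
    have : (|x| ^ 3) ^ 2 = (x ^ 2) ^ 3 := by rw [← hx2]; ring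
    rw [mul_pow, mul_pow, this, hy]; field_simp
  have e2 : n * (C₄ * |x| ^ 4) = C₄ * (8 / c) ^ 2 / n * y ^ 2 := by
    have : |x| ^ 4 = (x ^ 2) ^ 2 := by rw [← hx2]; ring
    rw [this, hy]; field_simp
  have e3 : Real.exp (-(n * c * x ^ 2 / 4)) * Real.exp y = Real.exp (-(n * c / 8) * x ^ 2) := by
    rw [← Real.exp_add, hy]; ring_nf
  rw [e1, e2, ← e3]
  calc Real.exp (-(n * c * x ^ 2 / 4)) * (C₃ ^ 2 * (8 / c) ^ 3 / n * y ^ 3 +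
        C₄ * (8 / c) ^ 2 / n * y ^ 2)
      ≤ Real.exp (-(n * c * x ^ 2 / 4)) * (C₃ ^ 2 * (8 / c) ^ 3 / n * (6 * Real.exp y) +
        C₄ * (8 / c) ^ 2 / n * (2 * Real.exp y)) := by gcongr
    _ = _ := by ring

theorem exp_tail_bound {c a : ℝ} (hc : 0 < c) (ha : 0 < a) {n : ℝ} (hn : 0 < n) {x : ℝ}
    (hx : a ≤ |x|) :
    Real.exp (-(n * c * x ^ 2 / 2)) ≤
      4 / (c * a ^ 2) / n * Real.exp (-(n * c / 8) * x ^ 2) := by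
  have hx2 : a ^ 2 ≤ x ^ 2 := by rw [← sq_abs x]; gcongr
  set y := n * c * a ^ 2 / 4 with hy
  have hy0 : 0 < y := by positivity
  have h1 : Real.exp (-y) ≤ 1 / y := by
    rw [Real.exp_neg, ← one_div]
    exact one_div_le_one_div_of_le hy0 (by linarith [Real.add_one_le_exp y])
  have h2 : 4 / (c * a ^ 2) / n = 1 / y := by rw [hy]; field_simp
  rw [h2]
  refine le_trans ?_ (mul_le_mul_of_nonneg_right h1 (Real.exp_pos _).le)
  rw [← Real.exp_add, Real.exp_le_exp, hy]
  have : n * c * a ^ 2 ≤ n * c * x ^ 2 := by gcongr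
  have : 0 ≤ n * c * x ^ 2 := by positivity
  nlinarith

theorem intervalIntegral_odd_eq_zero {f : ℝ → ℂ} (hf : ∀ x, f (-x) = -f x) (a : ℝ) :
    ∫ x in (-a)..a, f x = 0 := by
  have h1 := intervalIntegral.integral_comp_neg (a := -a) (b := a) f
  simp only [hf, neg_neg, intervalIntegral.integral_neg] at h1
  exact self_eq_neg.1 h1.symm

/-- Both `a` and `C` are chosen before `h`, `s` and `n`, so one choice serves all `z` near a real
point. Subtracting the odd cubic term costs nothing in the integral and improves the error from
`O(1/n)` to `O(n^{-3/2})`. -/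
theorem laplace_uniform {R M c : ℝ} (hR : 0 < R) (hM0 : 0 ≤ M) (hc : 0 < c) :
    ∃ a : ℝ, 0 < a ∧ a ≤ R / 4 ∧ ∃ C : ℝ, ∀ (h : ℂ → ℂ) (s : ℂ),
      DifferentiableOn ℂ h (Metric.ball 0 R) → (∀ z ∈ Metric.ball (0 : ℂ) R, ‖h z‖ ≤ M) →
      h 0 = 0 → deriv h 0 = 0 → deriv (deriv h) 0 = -s → c ≤ s.re → ∀ n : ℝ, 0 < n →
      ‖(∫ x in (-a)..a, Complex.exp (n * h x)) -
        (√(2 * Real.pi / n) : ℝ) * (1 / s) ^ (1 / 2 : ℂ)‖ ≤ C / (n * √n) := by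
  set C₃ := 2 * M * (2 / R) ^ 3 with hC₃
  set C₄ := 2 * M * (2 / R) ^ 4 with hC₄
  have h3 : 0 ≤ C₃ := by positivity
  have h4 : 0 ≤ C₄ := by positivity
  -- With `C₃ a ≤ c/4` the cubic remainder uses at most half of the Gaussian exponent `ncx²/2` on
  -- `[-a, a]`.
  obtain ⟨a, ha0, haR, haC⟩ : ∃ a : ℝ, 0 < a ∧ a ≤ R / 4 ∧ C₃ * a ≤ c / 4 := by
    refine ⟨min (R / 4) (c / 4 / (C₃ + 1)), by positivity, min_le_left _ _, ?_⟩
    calc C₃ * min (R / 4) (c / 4 / (C₃ + 1)) ≤ (C₃ + 1) * (c / 4 / (C₃ + 1)) := by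
          gcongr
          · linarith
          · exact min_le_right _ _
      _ = c / 4 := by field_simp
  set K := (C₃ ^ 2 * (8 / c) ^ 3 * 6 + C₄ * (8 / c) ^ 2 * 2) + 4 / (c * a ^ 2) with hK
  refine ⟨a, ha0, haR, K * √(8 * Real.pi / c), fun h s hd hM h0 h1 h2 hs n hn => ?_⟩
  have hs0 : 0 < s.re := hc.trans_le hs
  set b := iteratedDeriv 3 h 0 / 6 with hb
  have hE3 : ∀ x : ℝ, |x| ≤ a → ‖h x + s * x ^ 2 / 2‖ ≤ C₃ * |x| ^ 3 := by
    intro x hx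
    have := norm_sub_taylor_le hR hd hM 3 (z := x)
      (by rw [Complex.norm_real]; exact hx.trans haR)
    simp only [Finset.sum_range_succ, Finset.sum_range_zero, iteratedDeriv_zero, iteratedDeriv_succ,
      h0, h1, h2, Complex.norm_real, Real.norm_eq_abs] at this
    convert this using 2
    norm_num [Nat.factorial]; ring
  have hE4 : ∀ x : ℝ, |x| ≤ a → ‖h x + s * x ^ 2 / 2 - b * x ^ 3‖ ≤ C₄ * |x| ^ 4 := by
    intro x hx
    have := norm_sub_taylor_le hR hd hM 4 (z := x)
      (by rw [Complex.norm_real]; exact hx.trans haR)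
    have e2 : iteratedDeriv 2 h 0 = -s := by
      rw [iteratedDeriv_succ, iteratedDeriv_one, h2]
    simp only [Finset.sum_range_succ, Finset.sum_range_zero, iteratedDeriv_zero, iteratedDeriv_one,
      h0, h1, e2, Complex.norm_real, Real.norm_eq_abs] at this
    convert this using 2
    rw [hb]
    norm_num [Nat.factorial]; ring
  set A : ℝ → ℂ := fun x => n * (-s * x ^ 2 / 2) with hA
  have hAre : ∀ x, (A x).re = -(n * s.re * x ^ 2 / 2) := by
    intro x
    have : A x = ((-(n * x ^ 2 / 2) : ℝ) : ℂ) * s := by simp only [hA]; push_cast; ring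
    rw [this, Complex.re_ofReal_mul]; ring
  set I : Set ℝ := Set.Ioc (-a) a with hI
  set G : ℝ → ℂ := fun x => Complex.exp (n * h x) - Complex.exp (A x) * (n * (b * x ^ 3)) with hG
  -- The Gaussian is subtracted on the whole line, so its tail beyond `a` and the local error are
  -- bounded by one integrable function.
  set F : ℝ → ℂ := fun x => I.indicator G x - Complex.exp (A x) with hF
  have hAle : ∀ x, (A x).re ≤ -(n * c * x ^ 2 / 2) := by
    intro x
    rw [hAre]
    have : n * c * x ^ 2 ≤ n * s.re * x ^ 2 := by gcongr
    linarith
  have hexp : ∀ x, x ∈ I ∨ a ≤ |x| := by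
    intro x
    by_cases hx : x ∈ I
    · exact Or.inl hx
    · refine Or.inr ?_
      by_contra hc'
      push Not at hc'
      have := abs_lt.1 hc'
      exact hx ⟨this.1, this.2.le⟩
  have hbound : ∀ x, ‖F x‖ ≤ K / n * Real.exp (-(n * c / 8) * x ^ 2) := by
    intro x
    by_cases hx : x ∈ I
    · have hxa : |x| ≤ a := abs_le.2 ⟨hx.1.le, hx.2⟩
      have e : F x = Complex.exp (A x + n * (h x + s * x ^ 2 / 2)) -
          Complex.exp (A x) * (1 + n * (b * x ^ 3)) := by
        simp only [hF, Set.indicator_of_mem hx, hG]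
        have : A x + n * (h x + s * x ^ 2 / 2) = n * h x := by simp only [hA]; ring
        rw [this]; ring
      have n1 : ‖(n : ℂ) * (h x + s * x ^ 2 / 2)‖ ≤ n * (C₃ * |x| ^ 3) := by
        rw [norm_mul, Complex.norm_real, Real.norm_of_nonneg hn.le]
        exact mul_le_mul_of_nonneg_left (hE3 x hxa) hn.le
      have n2 : ‖(n : ℂ) * (h x + s * x ^ 2 / 2) - n * (b * x ^ 3)‖ ≤ n * (C₄ * |x| ^ 4) := by
        rw [← mul_sub, norm_mul, Complex.norm_real, Real.norm_of_nonneg hn.le]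
        exact mul_le_mul_of_nonneg_left (hE4 x hxa) hn.le
      have n3 : n * (C₃ * |x| ^ 3) ≤ n * c * x ^ 2 / 4 := by
        have e1 : C₃ * |x| ≤ c / 4 := (mul_le_mul_of_nonneg_left hxa h3).trans haC
        have e2 : |x| ^ 3 = |x| * x ^ 2 := by rw [← sq_abs x]; ring
        have := mul_le_mul_of_nonneg_right e1 (by positivity : 0 ≤ n * x ^ 2)
        rw [e2]; linarith
      rw [e]
      calc _ ≤ Real.exp ((A x).re + ‖(n : ℂ) * (h x + s * x ^ 2 / 2)‖) *
            (‖(n : ℂ) * (h x + s * x ^ 2 / 2)‖ ^ 2 +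
              ‖(n : ℂ) * (h x + s * x ^ 2 / 2) - n * (b * x ^ 3)‖) := norm_exp_add_sub_le _ _ _
        _ ≤ Real.exp (-(n * c * x ^ 2 / 4)) *
            ((n * (C₃ * |x| ^ 3)) ^ 2 + n * (C₄ * |x| ^ 4)) := by
            have := hAle x
            gcongr
            linarith
        _ ≤ _ := laplace_pointwise_bound h4 hc hn x
        _ ≤ _ := by
            have : 0 ≤ 4 / (c * a ^ 2) := by positivity
            gcongr
            rw [hK]; linarith
    · have hxa : a ≤ |x| := (hexp x).resolve_left hx
      have e : F x = -Complex.exp (A x) := by simp [hF, Set.indicator_of_notMem hx]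
      rw [e, norm_neg, Complex.norm_exp]
      calc _ ≤ Real.exp (-(n * c * x ^ 2 / 2)) := Real.exp_le_exp.2 (hAle x)
        _ ≤ _ := exp_tail_bound hc ha0 hn hxa
        _ ≤ _ := by
            have : 0 ≤ C₃ ^ 2 * (8 / c) ^ 3 * 6 + C₄ * (8 / c) ^ 2 * 2 := by positivity
            gcongr
            rw [hK]; linarith
  have hcont : ContinuousOn (fun x : ℝ => h x) (Set.Icc (-a) a) := by
    refine hd.continuousOn.comp Complex.continuous_ofReal.continuousOn fun x hx => ?_
    rw [mem_ball_zero_iff, Complex.norm_real, Real.norm_eq_abs]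
    have := abs_le.2 hx
    linarith
  have hle : -a ≤ a := by linarith
  have hAc : Continuous A := by fun_prop
  have hi1 : IntervalIntegrable (fun x : ℝ => Complex.exp (n * h x)) volume (-a) a := by
    refine ContinuousOn.intervalIntegrable ?_
    rw [Set.uIcc_of_le hle]
    exact (continuousOn_const.mul hcont).cexp
  have hi2 : IntervalIntegrable (fun x : ℝ => Complex.exp (A x) * (n * (b * x ^ 3))) volume
      (-a) a := Continuous.intervalIntegrable (by fun_prop) _ _
  have hodd : ∫ x in (-a)..a, Complex.exp (A x) * (n * (b * x ^ 3)) = 0 := by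
    refine intervalIntegral_odd_eq_zero (fun x => ?_) a
    simp only [hA]
    push_cast
    rw [neg_sq]; ring
  have hint : Integrable (fun x => Complex.exp (A x)) := by
    have := integrable_cexp_neg_mul_sq (b := (n / 2 : ℝ) * s)
      (by rw [Complex.re_ofReal_mul]; positivity)
    refine this.congr (Eventually.of_forall fun x => ?_)
    simp only [hA]
    push_cast
    congr 1; ring
  have hGi : Integrable (I.indicator G) := by
    rw [integrable_indicator_iff measurableSet_Ioc]
    exact ((hi1.sub hi2).1)
  have hFint : ∫ x, F x = (∫ x in (-a)..a, Complex.exp (n * h x)) -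
      (√(2 * Real.pi / n) : ℝ) * (1 / s) ^ (1 / 2 : ℂ) := by
    simp only [hF]
    rw [integral_sub hGi hint, integral_indicator measurableSet_Ioc,
      ← intervalIntegral.integral_of_le hle]
    simp only [hG]
    rw [intervalIntegral.integral_sub hi1 hi2, hodd, sub_zero]
    congr 1
    exact integral_exp_neg_mul_sq_div_two hs0 hn
  rw [← hFint]
  have hgi : Integrable fun x : ℝ => K / n * Real.exp (-(n * c / 8) * x ^ 2) :=
    (integrable_exp_neg_mul_sq (by positivity)).const_mul _
  refine (norm_integral_le_of_norm_le hgi (Eventually.of_forall hbound)).trans (le_of_eq ?_)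
  rw [integral_const_mul, integral_gaussian]
  have : Real.pi / (n * c / 8) = (8 * Real.pi / c) / n := by field_simp
  rw [this, Real.sqrt_div' _ hn.le]
  field_simp

/-! ### The generating function of the weights -/

/-- The function `1 + e^z (e^x - 1)`, whose powers generate the Stirling--Sibuya weights. -/
noncomputable def stirlingBase (z x : ℂ) : ℂ := 1 + Complex.exp z * (Complex.exp x - 1)

theorem continuous_stirlingBase : Continuous fun p : ℂ × ℂ => stirlingBase p.1 p.2 := by
  unfold stirlingBase; fun_prop

theorem hasDerivAt_stirlingBase (z x : ℂ) :
    HasDerivAt (stirlingBase z) (Complex.exp z * Complex.exp x) x :=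
  (((Complex.hasDerivAt_exp x).sub_const 1).const_mul (Complex.exp z)).const_add 1

theorem hasDerivAt_stirlingBase_mul (z L y : ℂ) :
    HasDerivAt (fun y => stirlingBase z (L * y)) (L * (Complex.exp z * Complex.exp (L * y))) y := by
  have := (hasDerivAt_stirlingBase z (L * y)).comp y ((hasDerivAt_id y).const_mul L)
  refine this.congr_deriv ?_
  ring

/-- The Stirling recurrence moved onto an arbitrary sequence: differentiating the `k`-th term of the
derivative formula yields exactly `k Q k + Q (k + 1)`. -/
theorem sum_stirlingSecond_succ_mul {R : Type*} [CommRing R] (n : ℕ) (Q : ℕ → R) :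
    ∑ k ∈ Finset.range (n + 2), (Nat.stirlingSecond (n + 1) k : R) * Q k =
      ∑ k ∈ Finset.range (n + 1), (Nat.stirlingSecond n k : R) * (k * Q k + Q (k + 1)) := by
  rw [Finset.sum_range_succ', Nat.stirlingSecond_succ_zero]
  have h1 := Finset.sum_range_succ' (fun k : ℕ => (Nat.stirlingSecond n k : R) * (k * Q k)) (n + 1)
  have h2 := Finset.sum_range_succ (fun k : ℕ => (Nat.stirlingSecond n k : R) * (k * Q k)) (n + 1)
  have h3 : (Nat.stirlingSecond n (n + 1) : R) = 0 := by
    exact_mod_cast congrArg (Nat.cast : ℕ → R) (Nat.stirlingSecond_eq_zero_of_lt (Nat.lt_succ_self n))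
  simp only [h3, Nat.cast_zero, zero_mul, mul_zero, add_zero] at h1 h2
  simp only [mul_add, Finset.sum_add_distrib]
  rw [← h2, h1, ← Finset.sum_add_distrib]
  simp only [Nat.cast_zero, zero_mul, add_zero]
  refine Finset.sum_congr rfl fun k _ => ?_
  rw [Nat.stirlingSecond_succ_succ]
  push_cast
  ring

/-- Induction needs the formula at all `y` with base in the slit plane, an open set, so that it can
be differentiated again. -/
theorem iteratedDeriv_stirlingBase_cpow (z L θ : ℂ) (n : ℕ) {y : ℂ}
    (hy : stirlingBase z (L * y) ∈ Complex.slitPlane) :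
    iteratedDeriv n (fun y => stirlingBase z (L * y) ^ θ) y =
      L ^ n * ∑ k ∈ Finset.range (n + 1), (Nat.stirlingSecond n k : ℂ) *
        ((∏ i ∈ Finset.range k, (θ - i)) * (Complex.exp z * Complex.exp (L * y)) ^ k *
          stirlingBase z (L * y) ^ (θ - k)) := by
  induction n generalizing y with
  | zero => simp
  | succ n ih =>
    have hcont : Continuous fun y => stirlingBase z (L * y) := by unfold stirlingBase; fun_prop
    have hopen := (Complex.isOpen_slitPlane.preimage hcont).mem_nhds hy
    rw [iteratedDeriv_succ, (Filter.eventuallyEq_of_mem hopen fun v hv => ih hv).deriv_eq,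
      sum_stirlingSecond_succ_mul]
    have hb := hasDerivAt_stirlingBase_mul z L y
    have he : HasDerivAt (fun y => Complex.exp z * Complex.exp (L * y))
        (Complex.exp z * (Complex.exp (L * y) * (L * 1))) y :=
      (((hasDerivAt_id y).const_mul L).cexp).const_mul (Complex.exp z)
    have hterm : ∀ k ∈ Finset.range (n + 1), HasDerivAt (fun y => (Nat.stirlingSecond n k : ℂ) *
        ((∏ i ∈ Finset.range k, (θ - i)) * (Complex.exp z * Complex.exp (L * y)) ^ k *
          stirlingBase z (L * y) ^ (θ - k)))
        (L * ((Nat.stirlingSecond n k : ℂ) *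
        (k * ((∏ i ∈ Finset.range k, (θ - i)) * (Complex.exp z * Complex.exp (L * y)) ^ k *
          stirlingBase z (L * y) ^ (θ - k)) +
        (∏ i ∈ Finset.range (k + 1), (θ - i)) * (Complex.exp z * Complex.exp (L * y)) ^ (k + 1) *
          stirlingBase z (L * y) ^ (θ - (k + 1 : ℕ))))) y := by
      intro k _
      have h1 := (((he.pow k).const_mul (∏ i ∈ Finset.range k, (θ - i))).mul
        (hb.cpow_const (c := θ - k) hy)).const_mul (Nat.stirlingSecond n k : ℂ)
      refine h1.congr_deriv ?_
      rw [Finset.prod_range_succ]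
      have e1 : θ - ((k + 1 : ℕ) : ℂ) = θ - k - 1 := by push_cast; ring
      rw [e1]
      rcases k with _ | k
      · simp; ring
      · simp only [Nat.add_sub_cancel, Pi.pow_apply, pow_succ]
        push_cast
        ring
    rw [((HasDerivAt.fun_sum hterm).const_mul (L ^ n)).deriv, ← Finset.mul_sum, pow_succ]
    push_cast
    ring

theorem iteratedDeriv_stirlingBase_cpow_zero (z L θ : ℂ) (n : ℕ) :
    iteratedDeriv n (fun y => stirlingBase z (L * y) ^ θ) 0 =
      L ^ n * ∑ k ∈ Finset.range (n + 1), (Nat.stirlingSecond n k : ℂ) *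
        ((∏ i ∈ Finset.range k, (θ - i)) * Complex.exp z ^ k) := by
  rw [iteratedDeriv_stirlingBase_cpow z L θ n (by simp [stirlingBase])]
  simp [stirlingBase]

theorem complexMGF_stirlingSibuya {n : ℕ} {θ : ℝ} (h : StirlingSibuyaAdmissible n θ) (z : ℂ) :
    complexMGF id (stirlingSibuya n θ) z =
      (∑ k ∈ Finset.range (n + 1), (Nat.stirlingSecond n k : ℂ) *
        ((∏ i ∈ Finset.range k, ((θ : ℂ) - i)) * Complex.exp z ^ k)) / (θ : ℂ) ^ n := by
  have h2 : (Nat.stirlingSecond n 0 : ℂ) = 0 := by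
    obtain ⟨m, rfl⟩ : ∃ m, n = m + 1 := ⟨n - 1, by have := h.1; omega⟩
    simp [Nat.stirlingSecond_succ_zero]
  have h3 : Finset.Icc 1 n = Finset.Ico (0 + 1) (n + 1) := by ext; simp
  rw [Finset.range_eq_Ico, Finset.sum_eq_sum_Ico_succ_bot (Nat.succ_pos n), h2, zero_mul,
    zero_add, ← h3, complexMGF, stirlingSibuya, integral_finsetSum_measure, Finset.sum_div]
  · refine Finset.sum_congr rfl fun k hk => ?_
    rw [integral_smul_measure, integral_dirac,
      ENNReal.toReal_ofReal (stirlingSibuyaWeight_nonneg h (Finset.mem_Icc.1 hk).2)]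
    rw [← Complex.exp_nat_mul]
    simp only [stirlingSibuyaWeight, id, Complex.real_smul]
    push_cast
    rw [mul_comm z]
    ring
  · intro k _
    exact (integrable_dirac (by simp)).smul_measure ENNReal.ofReal_ne_top

theorem mem_integrableExpSet_stirlingSibuya (n : ℕ) (θ t : ℝ) :
    t ∈ integrableExpSet id (stirlingSibuya n θ) := by
  simp only [integrableExpSet, Set.mem_ofPred_eq, stirlingSibuya, integrable_finsetSum_measure]
  exact fun k _ => (integrable_dirac (by simp)).smul_measure ENNReal.ofReal_ne_top

/-! ### Cauchy's coefficient formula -/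

theorem integral_circle_eq_iteratedDeriv {f : ℂ → ℂ} {ρ : ℝ} (hρ : 0 < ρ)
    (hf : DifferentiableOn ℂ f (Metric.closedBall 0 ρ)) (n : ℕ) :
    ∫ α in (-Real.pi)..Real.pi, f (ρ * Complex.exp (α * Complex.I)) /
        (ρ * Complex.exp (α * Complex.I)) ^ n =
      2 * Real.pi / n.factorial * iteratedDeriv n f 0 := by
  have h1 := hf.circleIntegral_one_div_sub_center_pow_smul hρ n
  set g : ℝ → ℂ := fun α => f (ρ * Complex.exp (α * Complex.I)) /
        (ρ * Complex.exp (α * Complex.I)) ^ n with hg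
  have hp : Function.Periodic g (2 * Real.pi) := by
    intro α
    simp only [hg]
    push_cast
    rw [add_mul, Complex.exp_add, Complex.exp_two_pi_mul_I, mul_one]
  have h2 := hp.intervalIntegral_add_eq (-Real.pi) 0
  rw [show -Real.pi + 2 * Real.pi = Real.pi by ring, zero_add] at h2
  rw [h2]
  have h3 : ∮ z in C(0, ρ), (1 / (z - 0) ^ (n + 1)) • f z =
      Complex.I * ∫ α in (0 : ℝ)..2 * Real.pi, g α := by
    rw [circleIntegral, ← intervalIntegral.integral_const_mul]
    refine intervalIntegral.integral_congr fun α _ => ?_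
    have h0 : (ρ : ℂ) * Complex.exp (α * Complex.I) ≠ 0 :=
      mul_ne_zero (by exact_mod_cast hρ.ne') (Complex.exp_ne_zero _)
    simp only [deriv_circleMap, circleMap, zero_add, sub_zero, smul_eq_mul, hg]
    field_simp
    ring
  rw [h3] at h1
  have h4 : Complex.I * ∫ α in (0 : ℝ)..2 * Real.pi, g α =
      Complex.I * (2 * Real.pi / n.factorial * iteratedDeriv n f 0) := by
    rw [h1, smul_eq_mul]; ring
  exact mul_left_cancel₀ Complex.I_ne_zero h4

/-! ### Stirling's formula with relative error `1/n` -/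

/-- The sequence `log (stirlingSeq n) - 1/(12n)` is nondecreasing, since the increments telescope
against `1/(12n(n+1))`, and it tends to `log √π`. -/
theorem stirlingSeq_le (n : ℕ) (hn : 1 ≤ n) :
    Stirling.stirlingSeq n ≤ √Real.pi * Real.exp (1 / (12 * n)) := by
  have hmono : ∀ m : ℕ, 1 ≤ m → Real.log (Stirling.stirlingSeq n) - 1 / (12 * n) ≤
      Real.log (Stirling.stirlingSeq (n + m)) - 1 / (12 * (n + m : ℕ)) := by
    intro m hm
    induction m, hm using Nat.le_induction with
    | base =>
      have h := Stirling.log_stirlingSeq_sdiff_le n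
      have hn' : (0 : ℝ) < n := by exact_mod_cast hn
      have e : 1 / (12 * (n : ℝ) * (n + 1)) = 1 / (12 * n) - 1 / (12 * (n + 1 : ℕ)) := by
        push_cast; field_simp; ring
      linarith
    | succ m _ ih =>
      have h := Stirling.log_stirlingSeq_sdiff_le (n + m)
      have hn' : (0 : ℝ) < (n + m : ℕ) := by exact_mod_cast (by omega : 0 < n + m)
      have e : 1 / (12 * ((n + m : ℕ) : ℝ) * ((n + m : ℕ) + 1)) =
          1 / (12 * (n + m : ℕ)) - 1 / (12 * (n + (m + 1) : ℕ)) := by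
        rw [← add_assoc, Nat.cast_add_one (n + m)]; field_simp; ring
      rw [← add_assoc] at e ⊢
      linarith
  have hlim : Tendsto (fun m : ℕ => Real.log (Stirling.stirlingSeq (n + m)) -
      1 / (12 * (n + m : ℕ))) atTop (𝓝 (Real.log √Real.pi - 0)) := by
    have h1 : Tendsto (fun m : ℕ => n + m) atTop atTop :=
      tendsto_atTop_mono (fun m => Nat.le_add_left m n) tendsto_id
    have hpi : √Real.pi ≠ 0 := (Real.sqrt_pos.2 Real.pi_pos).ne'
    refine ((Stirling.tendsto_stirlingSeq_sqrt_pi.log hpi).comp h1).sub ?_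
    have h2 : Tendsto (fun m : ℕ => 12 * (m : ℝ)) atTop atTop :=
      tendsto_natCast_atTop_atTop.const_mul_atTop (by norm_num)
    have h3 := (tendsto_inv_atTop_zero.comp h2).comp h1
    refine h3.congr fun m => ?_
    simp
  have h := ge_of_tendsto hlim (eventually_atTop.2 ⟨1, hmono⟩)
  have hpos : 0 < Stirling.stirlingSeq n := by
    obtain ⟨m, rfl⟩ : ∃ m, n = m + 1 := ⟨n - 1, by omega⟩
    exact Stirling.stirlingSeq'_pos m
  have hpi : 0 < √Real.pi := Real.sqrt_pos.2 Real.pi_pos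
  rw [← Real.exp_log hpos, ← Real.exp_log hpi, ← Real.exp_add]
  exact Real.exp_le_exp.2 (by linarith)

theorem factorial_stirling_bounds (n : ℕ) (hn : 1 ≤ n) :
    1 ≤ n.factorial * Real.exp n / n ^ n / √(2 * Real.pi * n) ∧
      n.factorial * Real.exp n / n ^ n / √(2 * Real.pi * n) ≤ 1 + 1 / n := by
  have hn0 : (0 : ℝ) < n := by exact_mod_cast hn
  have hn1 : (1 : ℝ) ≤ n := by exact_mod_cast hn
  have hpi : 0 < √Real.pi := Real.sqrt_pos.2 Real.pi_pos
  have e : n.factorial * Real.exp n / n ^ n / √(2 * Real.pi * n) =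
      Stirling.stirlingSeq n / √Real.pi := by
    have e1 : √(2 * Real.pi * n) = √(2 * n) * √Real.pi := by
      rw [← Real.sqrt_mul (by positivity)]; ring_nf
    have e2 : Real.exp n = Real.exp 1 ^ n := by rw [← Real.exp_nat_mul, mul_one]
    rw [Stirling.stirlingSeq, e1, e2, div_pow]
    have : 0 < √(2 * (n : ℝ)) := Real.sqrt_pos.2 (by positivity)
    field_simp
  rw [e]
  refine ⟨(one_le_div hpi).2 (Stirling.sqrt_pi_le_stirlingSeq (by omega)), ?_⟩
  rw [div_le_iff₀ hpi, mul_comm]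
  refine (stirlingSeq_le n hn).trans (mul_le_mul_of_nonneg_left ?_ hpi.le)
  have h1 : 1 / (12 * (n : ℝ)) ≤ 1 / 12 := by
    apply one_div_le_one_div_of_le <;> linarith
  have h0 : 0 < 1 / (12 * (n : ℝ)) := by positivity
  -- With `u = 1/(12n) ≤ 1/12`, `e^u ≤ 1 + u + u² ≤ 1 + 12u`.
  have h2 := Real.abs_exp_sub_one_sub_id_le (x := 1 / (12 * (n : ℝ))) (by rw [abs_of_pos h0]; linarith)
  have h3 := (abs_le.1 h2).2
  have h4 : 1 / (n : ℝ) = 12 * (1 / (12 * n)) := by field_simp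
  rw [h4]
  nlinarith

/-! ### The contour in logarithmic coordinates -/

/-- The part of the polygonal contour in logarithmic coordinates on which the integrand is small. -/
def contourEdges (a α₁ B : ℝ) : Set ℂ :=
  {w | |w.re| = α₁ ∧ w.im ∈ Set.Icc 0 B} ∪ {w | |w.re| ∈ Set.Icc α₁ Real.pi ∧ w.im = B} ∪
    {w | |w.re| ∈ Set.Icc a α₁ ∧ w.im = 0}

theorem isCompact_contourEdges {a α₁ B : ℝ} (hα₁ : α₁ ≤ Real.pi) (hB : 0 ≤ B) :
    IsCompact (contourEdges a α₁ B) := by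
  have hK : IsCompact (Set.Icc (-Real.pi) Real.pi ×ℂ Set.Icc 0 B) :=
    isCompact_Icc.reProdIm isCompact_Icc
  have c1 : Continuous fun w : ℂ => |w.re| := by fun_prop
  refine hK.of_isClosed_subset ?_ ?_
  · refine ((IsClosed.inter ?_ ?_).union (IsClosed.inter ?_ ?_)).union (IsClosed.inter ?_ ?_)
    · exact isClosed_eq c1 continuous_const
    · exact isClosed_Icc.preimage Complex.continuous_im
    · exact isClosed_Icc.preimage c1
    · exact isClosed_eq Complex.continuous_im continuous_const
    · exact isClosed_Icc.preimage c1
    · exact isClosed_eq Complex.continuous_im continuous_const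
  · rintro w ((⟨h1, h2⟩ | ⟨h1, h2⟩) | ⟨h1, h2⟩)
    · exact ⟨abs_le.1 (h1.le.trans hα₁), h2⟩
    · exact ⟨abs_le.1 h1.2, by simp [h2, hB]⟩
    · exact ⟨abs_le.1 (h1.2.trans hα₁), by simp [h2, hB]⟩

/-- In the coordinate `y = e^{iw}` the small circle of radius `e^{-B}` is the segment `Im w = B`.
Its part over `[-α₁, α₁]` is pushed down to `Im w = 0` by Cauchy's theorem on a rectangle. Nothing
is assumed where `|Re w| > α₁` and `Im w < B`, which leaves room for a branch cut along the negative
axis. -/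
theorem norm_contour_sub_le {f : ℂ → ℂ} {n : ℕ} {a α₁ B m : ℝ} (ha : 0 < a) (haα : a ≤ α₁)
    (hα : α₁ ≤ Real.pi) (hB : 0 ≤ B)
    (hf : DifferentiableOn ℂ f (Metric.closedBall 0 (Real.exp (-B))))
    (hf' : ∀ w ∈ Set.Icc (-α₁) α₁ ×ℂ Set.Icc 0 B, DifferentiableAt ℂ f (Complex.exp (w * Complex.I)))
    (hm : ∀ w ∈ contourEdges a α₁ B,
      ‖f (Complex.exp (w * Complex.I)) / Complex.exp (w * Complex.I) ^ n‖ ≤ m) :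
    ‖2 * Real.pi / n.factorial * iteratedDeriv n f 0 -
      ∫ x in (-a)..a, f (Complex.exp ((x : ℂ) * Complex.I)) / Complex.exp ((x : ℂ) * Complex.I) ^ n‖ ≤
      (2 * Real.pi + 2 * B) * m := by
  set q : ℂ → ℂ := fun w => f (Complex.exp (w * Complex.I)) / Complex.exp (w * Complex.I) ^ n with hq
  have hqd : ∀ w ∈ Set.Icc (-α₁) α₁ ×ℂ Set.Icc 0 B, DifferentiableAt ℂ q w := by
    intro w hw
    have h1 : DifferentiableAt ℂ (fun w => f (Complex.exp (w * Complex.I))) w :=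
      (hf' w hw).comp w (by fun_prop)
    exact h1.div (by fun_prop) (pow_ne_zero _ (Complex.exp_ne_zero _))
  have hcirc : ∀ x : ℝ, Complex.exp ((x + B * Complex.I) * Complex.I) =
      ((Real.exp (-B) : ℝ) : ℂ) * Complex.exp (x * Complex.I) := by
    intro x
    rw [Complex.ofReal_exp, ← Complex.exp_add]
    congr 1
    push_cast
    linear_combination (B : ℂ) * Complex.I_mul_I
  have h1 := integral_circle_eq_iteratedDeriv (Real.exp_pos (-B)) hf n
  simp only [← hcirc] at h1
  change ∫ x in (-Real.pi)..Real.pi, q (x + B * Complex.I) = _ at h1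
  have hqB : Continuous fun x : ℝ => q (x + B * Complex.I) := by
    have : Continuous fun x : ℝ => f (Complex.exp ((x + B * Complex.I) * Complex.I)) := by
      refine hf.continuousOn.comp_continuous (by fun_prop) fun x => ?_
      rw [hcirc, mem_closedBall_zero_iff, norm_mul, Complex.norm_exp_ofReal_mul_I, mul_one,
        Complex.norm_real, Real.norm_of_nonneg (Real.exp_pos _).le]
    exact this.div (by fun_prop) fun x => pow_ne_zero _ (Complex.exp_ne_zero _)
  have hq0 : ContinuousOn (fun x : ℝ => q x) (Set.Icc (-α₁) α₁) := by
    intro x hx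
    refine ((hqd x ⟨by simpa using hx, by simpa using hB⟩).continuousAt.comp
      Complex.continuous_ofReal.continuousAt).continuousWithinAt
  have hrect := Complex.integral_boundary_rect_eq_zero_of_differentiableOn q
    (((-α₁ : ℝ) : ℂ)) (α₁ + B * Complex.I) (by
      intro w hw
      refine (hqd w ?_).differentiableWithinAt
      have hle : -α₁ ≤ α₁ := by linarith
      simpa [Set.uIcc_of_le hle, Set.uIcc_of_le hB] using hw)
  simp only [Complex.ofReal_re, Complex.ofReal_im, Complex.add_re, Complex.mul_re, Complex.I_re,
    Complex.I_im, Complex.add_im, Complex.mul_im, mul_zero, mul_one, sub_zero, add_zero, zero_add,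
    Complex.ofReal_zero, zero_mul, smul_eq_mul] at hrect
  have s1 := intervalIntegral.integral_add_adjacent_intervals
    (hqB.intervalIntegrable (μ := volume) (-Real.pi) (-α₁)) (hqB.intervalIntegrable (-α₁) α₁)
  have s2 := intervalIntegral.integral_add_adjacent_intervals
    (hqB.intervalIntegrable (μ := volume) (-Real.pi) α₁) (hqB.intervalIntegrable α₁ Real.pi)
  have hii : ∀ u v : ℝ, -α₁ ≤ u → u ≤ v → v ≤ α₁ →
      IntervalIntegrable (fun x : ℝ => q x) volume u v := by
    intro u v h1 h2 h3
    refine ContinuousOn.intervalIntegrable ?_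
    rw [Set.uIcc_of_le h2]
    exact hq0.mono (Set.Icc_subset_Icc h1 h3)
  have s3 := intervalIntegral.integral_add_adjacent_intervals
    (hii (-α₁) (-a) le_rfl (by linarith) (by linarith)) (hii (-a) a (by linarith) (by linarith) haα)
  have s4 := intervalIntegral.integral_add_adjacent_intervals
    (hii (-α₁) a le_rfl (by linarith) haα) (hii a α₁ (by linarith) haα le_rfl)
  -- What remains are two top pieces, two bottom pieces beyond `±a` and two vertical sides, of total
  -- length at most `2π + 2B`.
  have key : 2 * Real.pi / n.factorial * iteratedDeriv n f 0 - ∫ x in (-a)..a, q x =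
      (∫ x in (-Real.pi)..(-α₁), q (x + B * Complex.I)) +
      (∫ x in α₁..Real.pi, q (x + B * Complex.I)) +
      (∫ x : ℝ in (-α₁)..(-a), q x) + (∫ x : ℝ in a..α₁, q x) +
      Complex.I * (∫ y in (0 : ℝ)..B, q (α₁ + y * Complex.I)) -
      Complex.I * (∫ y in (0 : ℝ)..B, q ((-α₁ : ℝ) + y * Complex.I)) := by
    rw [← h1]
    linear_combination -hrect - s1 - s2 - s3 - s4
  change ‖2 * Real.pi / n.factorial * iteratedDeriv n f 0 - ∫ x in (-a)..a, q x‖ ≤ _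
  rw [key]
  have b1 : ‖∫ x in (-Real.pi)..(-α₁), q (x + B * Complex.I)‖ ≤ m * |-α₁ - -Real.pi| := by
    refine intervalIntegral.norm_integral_le_of_norm_le_const fun x hx => hm _ (Or.inl (Or.inr ?_))
    rw [Set.uIoc_of_le (by linarith)] at hx
    have : |x| = -x := abs_of_nonpos (by linarith [hx.2])
    simp only [Set.mem_ofPred_eq, Complex.add_re, Complex.ofReal_re, Complex.mul_re, Complex.I_re,
      Complex.I_im, Complex.ofReal_im, mul_zero, sub_zero, add_zero, Complex.add_im,
      Complex.mul_im, mul_one, zero_add, this, Set.mem_Icc, and_true]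
    exact ⟨by linarith [hx.2], by linarith [hx.1]⟩
  have b2 : ‖∫ x in α₁..Real.pi, q (x + B * Complex.I)‖ ≤ m * |Real.pi - α₁| := by
    refine intervalIntegral.norm_integral_le_of_norm_le_const fun x hx => hm _ (Or.inl (Or.inr ?_))
    rw [Set.uIoc_of_le hα] at hx
    have : |x| = x := abs_of_nonneg (by linarith [hx.1])
    simp only [Set.mem_ofPred_eq, Complex.add_re, Complex.ofReal_re, Complex.mul_re, Complex.I_re,
      Complex.I_im, Complex.ofReal_im, mul_zero, sub_zero, add_zero, Complex.add_im,
      Complex.mul_im, mul_one, zero_add, this, Set.mem_Icc, and_true]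
    exact ⟨hx.1.le, hx.2⟩
  have b3 : ‖∫ x : ℝ in (-α₁)..(-a), q x‖ ≤ m * |-a - -α₁| := by
    refine intervalIntegral.norm_integral_le_of_norm_le_const fun x hx => hm _ (Or.inr ?_)
    rw [Set.uIoc_of_le (by linarith)] at hx
    have : |x| = -x := abs_of_nonpos (by linarith [hx.2])
    simp only [Set.mem_ofPred_eq, Complex.ofReal_re, Complex.ofReal_im, this, Set.mem_Icc, and_true]
    exact ⟨by linarith [hx.2], by linarith [hx.1]⟩
  have b4 : ‖∫ x : ℝ in a..α₁, q x‖ ≤ m * |α₁ - a| := by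
    refine intervalIntegral.norm_integral_le_of_norm_le_const fun x hx => hm _ (Or.inr ?_)
    rw [Set.uIoc_of_le haα] at hx
    have : |x| = x := abs_of_nonneg (by linarith [hx.1])
    simp only [Set.mem_ofPred_eq, Complex.ofReal_re, Complex.ofReal_im, this, Set.mem_Icc, and_true]
    exact ⟨hx.1.le, hx.2⟩
  have b5 : ∀ c : ℝ, |c| = α₁ → ‖Complex.I * ∫ y in (0 : ℝ)..B, q (c + y * Complex.I)‖ ≤
      m * |B - 0| := by
    intro c hc
    rw [norm_mul, Complex.norm_I, one_mul]
    refine intervalIntegral.norm_integral_le_of_norm_le_const fun x hx => hm _ (Or.inl (Or.inl ?_))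
    rw [Set.uIoc_of_le hB] at hx
    simp only [Set.mem_ofPred_eq, Complex.add_re, Complex.ofReal_re, Complex.mul_re, Complex.I_re,
      Complex.I_im, Complex.ofReal_im, mul_zero, sub_zero, add_zero, Complex.add_im,
      Complex.mul_im, mul_one, zero_add, hc, Set.mem_Icc, true_and]
    exact ⟨hx.1.le, hx.2⟩
  have b6 := b5 α₁ (abs_of_nonneg (by linarith))
  have b7 := b5 (-α₁) (by rw [abs_neg, abs_of_nonneg (by linarith)])
  have hm0 : 0 ≤ m := (norm_nonneg _).trans
    (hm (a : ℂ) (Or.inr ⟨by simp [abs_of_pos ha, haα], by simp⟩))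
  rw [abs_of_nonneg (by linarith)] at b1 b2 b3 b4 b6 b7
  refine (norm_sub_le _ _).trans ((add_le_add ((norm_add_le _ _).trans (add_le_add
    ((norm_add_le _ _).trans (add_le_add ((norm_add_le _ _).trans (add_le_add
      ((norm_add_le _ _).trans (add_le_add b1 b2)) b3)) b4)) b6)) b7).trans ?_)
  have := mul_nonneg hm0 ha.le
  nlinarith

/-! ### Saddle point formulas at complex points -/

theorem stirlingBase_eq_of_eqn {ϑ : ℝ} {z L : ℂ}
    (h : (ϑ * L - 1) * Complex.exp L = Complex.exp (-z) - 1) :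
    stirlingBase z L = Complex.exp z * (ϑ * L * Complex.exp L) := by
  have h1 : Complex.exp z * Complex.exp (-z) = 1 := by rw [← Complex.exp_add]; simp
  unfold stirlingBase
  linear_combination -Complex.exp z * h - h1

/-- The conditions at a complex point near the real axis under which the saddle point formulas
hold. -/
structure IsRegularPoint (ϑ : ℝ) (z : ℂ) : Prop where
  eqn : (ϑ * sibuyaL ϑ z - 1) * Complex.exp (sibuyaL ϑ z) = Complex.exp (-z) - 1
  ne_zero : sibuyaL ϑ z ≠ 0
  mem_slitPlane : stirlingBase z (sibuyaL ϑ z) ∈ Complex.slitPlane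
  log_eq : Complex.log (stirlingBase z (sibuyaL ϑ z)) =
    Real.log ϑ + Complex.log (sibuyaL ϑ z) + z + sibuyaL ϑ z

theorem IsSaddle.stirlingBase_pos {ϑ t r : ℝ} (h : IsSaddle ϑ t r) (hϑ : 0 < ϑ) :
    ∃ F : ℝ, 0 < F ∧ stirlingBase t r = F := by
  have hr := h.pos
  refine ⟨Real.exp t * (ϑ * r * Real.exp r), by positivity, ?_⟩
  rw [stirlingBase_eq_of_eqn (ϑ := ϑ) (z := t) (L := r) (by exact_mod_cast h.eqn)]
  push_cast; rfl

/-- The two sides of `log_eq` always have equal exponentials. At `t` the imaginary part of the right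
side is zero, so by continuity it stays in `(-π, π)` and no multiple of `2πi` appears. -/
theorem IsSaddle.eventually_isRegularPoint {ϑ t r : ℝ} (h : IsSaddle ϑ t r) (hϑ : 0 < ϑ) :
    ∀ᶠ z in 𝓝 (t : ℂ), IsRegularPoint ϑ z := by
  have hL := (h.analyticAt_sibuyaL hϑ).continuousAt
  have hr := h.sibuyaL_eq hϑ
  have hlog := hL.clog (h.sibuyaL_mem_slitPlane hϑ)
  have hF : ContinuousAt (fun z => stirlingBase z (sibuyaL ϑ z)) (t : ℂ) :=
    continuous_stirlingBase.continuousAt.comp (continuousAt_id.prodMk hL)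
  obtain ⟨F, hF0, hFe⟩ := h.stirlingBase_pos hϑ
  have e1 : ∀ᶠ z in 𝓝 (t : ℂ), stirlingBase z (sibuyaL ϑ z) ∈ Complex.slitPlane := by
    refine hF.eventually_mem (Complex.isOpen_slitPlane.mem_nhds ?_)
    rw [hr, hFe]; exact Complex.ofReal_mem_slitPlane.2 hF0
  have e2 : ∀ᶠ z in 𝓝 (t : ℂ), sibuyaL ϑ z ≠ 0 := by
    refine hL.eventually_ne ?_
    rw [hr]; exact_mod_cast h.pos.ne'
  have e3 : ∀ᶠ z in 𝓝 (t : ℂ),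
      (Complex.log (sibuyaL ϑ z) + z + sibuyaL ϑ z).im ∈ Set.Ioo (-Real.pi) Real.pi := by
    have : ContinuousAt (fun z => (Complex.log (sibuyaL ϑ z) + z + sibuyaL ϑ z).im) (t : ℂ) :=
      Complex.continuous_im.continuousAt.comp ((hlog.add continuousAt_id).add hL)
    refine this.eventually_mem (isOpen_Ioo.mem_nhds ?_)
    rw [hr, ← Complex.ofReal_log h.pos.le]
    simpa using Real.pi_pos
  filter_upwards [h.sibuyaL_eqn_eventually hϑ, e1, e2, e3] with z h1 h2 h3 h4
  refine ⟨h1, h3, h2, ?_⟩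
  rw [stirlingBase_eq_of_eqn h1]
  have h5 : Complex.exp (Real.log ϑ + Complex.log (sibuyaL ϑ z) + z + sibuyaL ϑ z) =
      Complex.exp z * (ϑ * sibuyaL ϑ z * Complex.exp (sibuyaL ϑ z)) := by
    rw [Complex.exp_add, Complex.exp_add, Complex.exp_add, Complex.exp_log h3,
      ← Complex.ofReal_exp, Real.exp_log hϑ]
    ring
  rw [← h5]
  have h6 : (Real.log ϑ + Complex.log (sibuyaL ϑ z) + z + sibuyaL ϑ z).im =
      (Complex.log (sibuyaL ϑ z) + z + sibuyaL ϑ z).im := by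
    simp
  exact Complex.log_exp (by rw [h6]; exact h4.1) (by rw [h6]; exact h4.2.le)

/-- Rescaling `y` by `L` places the saddle at `1`. By `log_eq`, `F(L)^{ϑn} = ϑ^n e^n L^n e^{nφ₃}`;
the powers of `ϑ` and `L` cancel, and only the Stirling factor `n! e^n / n^n` remains. -/
theorem IsRegularPoint.normalizedLaplace_eq {ϑ : ℝ} {z : ℂ} (hz : IsRegularPoint ϑ z) (hϑ : 0 < ϑ)
    {n : ℕ} (hn : StirlingSibuyaAdmissible n (ϑ * n)) :
    normalizedLaplace (stirlingSibuya n (ϑ * n)) n (sibuyaPhi ϑ) z =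
      (n.factorial * Real.exp n / n ^ n : ℝ) *
        (iteratedDeriv n (fun y => stirlingBase z (sibuyaL ϑ z * y) ^ ((ϑ * n : ℝ) : ℂ)) 0 /
          n.factorial / stirlingBase z (sibuyaL ϑ z) ^ ((ϑ * n : ℝ) : ℂ)) := by
  have hF0 := Complex.slitPlane_ne_zero hz.mem_slitPlane
  have hn0 : (n : ℂ) ≠ 0 := by
    have := hn.1
    exact_mod_cast (by omega : n ≠ 0)
  have hϑ0 : (ϑ : ℂ) ≠ 0 := by exact_mod_cast hϑ.ne'
  have hf : (n.factorial : ℂ) ≠ 0 := by exact_mod_cast n.factorial_ne_zero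
  have hL0 := hz.ne_zero
  have key : stirlingBase z (sibuyaL ϑ z) ^ ((ϑ * n : ℝ) : ℂ) =
      (ϑ : ℂ) ^ n * Complex.exp n * sibuyaL ϑ z ^ n * Complex.exp (n * sibuyaPhi ϑ z) := by
    have e1 : (ϑ : ℂ) ^ n = Complex.exp (n * Real.log ϑ) := by
      rw [Complex.exp_nat_mul, ← Complex.ofReal_exp, Real.exp_log hϑ]
    have e2 : sibuyaL ϑ z ^ n = Complex.exp (n * Complex.log (sibuyaL ϑ z)) := by
      rw [Complex.exp_nat_mul, Complex.exp_log hL0]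
    rw [Complex.cpow_def_of_ne_zero hF0, hz.log_eq, e1, e2, ← Complex.exp_add, ← Complex.exp_add,
      ← Complex.exp_add]
    congr 1
    unfold sibuyaPhi
    push_cast
    ring
  rw [key, iteratedDeriv_stirlingBase_cpow_zero, normalizedLaplace, complexMGF_stirlingSibuya hn]
  have h1 := Complex.exp_ne_zero (n * sibuyaPhi ϑ z)
  have h2 := Complex.exp_ne_zero (n : ℂ)
  push_cast
  rw [mul_pow]
  field_simp

/-! ### The exponent at the saddle point -/

/-- The exponent of the integrand on the circle through the saddle point, in logarithmic
coordinates. -/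
noncomputable def saddleExponent (ϑ : ℝ) (z w : ℂ) : ℂ :=
  ϑ * (Complex.log (stirlingBase z (sibuyaL ϑ z * Complex.exp (w * Complex.I))) -
    Complex.log (stirlingBase z (sibuyaL ϑ z))) - w * Complex.I

theorem hasDerivAt_mul_exp_mul_I (L w : ℂ) :
    HasDerivAt (fun w => L * Complex.exp (w * Complex.I))
      (L * Complex.exp (w * Complex.I) * Complex.I) w := by
  refine ((((hasDerivAt_id w).mul_const Complex.I).cexp).const_mul L).congr_deriv ?_
  simp only [id]; ring

theorem hasDerivAt_saddleExponent {ϑ : ℝ} {z w : ℂ}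
    (h : stirlingBase z (sibuyaL ϑ z * Complex.exp (w * Complex.I)) ∈ Complex.slitPlane) :
    HasDerivAt (saddleExponent ϑ z)
      (ϑ * (Complex.exp z * Complex.exp (sibuyaL ϑ z * Complex.exp (w * Complex.I)) *
        (sibuyaL ϑ z * Complex.exp (w * Complex.I) * Complex.I) /
        stirlingBase z (sibuyaL ϑ z * Complex.exp (w * Complex.I))) - Complex.I) w := by
  have h1 := (hasDerivAt_stirlingBase z _).comp w (hasDerivAt_mul_exp_mul_I (sibuyaL ϑ z) w)
  have h2 := (((h1.clog h).sub_const (Complex.log (stirlingBase z (sibuyaL ϑ z)))).const_mul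
    (ϑ : ℂ)).sub ((hasDerivAt_id w).mul_const Complex.I)
  refine h2.congr_deriv ?_
  rw [one_mul]
  rfl

theorem saddleExponent_zero (ϑ : ℝ) (z : ℂ) : saddleExponent ϑ z 0 = 0 := by
  simp [saddleExponent]

theorem IsRegularPoint.deriv_saddleExponent {ϑ : ℝ} {z : ℂ} (hz : IsRegularPoint ϑ z)
    (hϑ : 0 < ϑ) : deriv (saddleExponent ϑ z) 0 = 0 := by
  have h0 : sibuyaL ϑ z * Complex.exp (0 * Complex.I) = sibuyaL ϑ z := by simp
  have := hasDerivAt_saddleExponent (ϑ := ϑ) (z := z) (w := 0) (by rw [h0]; exact hz.mem_slitPlane)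
  rw [this.deriv, h0, stirlingBase_eq_of_eqn hz.eqn]
  have h1 := Complex.exp_ne_zero z
  have h2 := Complex.exp_ne_zero (sibuyaL ϑ z)
  have h3 := hz.ne_zero
  have h4 : (ϑ : ℂ) ≠ 0 := by exact_mod_cast hϑ.ne'
  field_simp
  ring

theorem IsRegularPoint.deriv_deriv_saddleExponent {ϑ : ℝ} {z : ℂ} (hz : IsRegularPoint ϑ z)
    (hϑ : 0 < ϑ) : deriv (deriv (saddleExponent ϑ z)) 0 =
      -((ϑ * sibuyaL ϑ z + ϑ - 1) / ϑ) := by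
  have h0 : sibuyaL ϑ z * Complex.exp (0 * Complex.I) = sibuyaL ϑ z := by simp
  have hc : Continuous fun w => stirlingBase z (sibuyaL ϑ z * Complex.exp (w * Complex.I)) := by
    unfold stirlingBase; fun_prop
  have hm : stirlingBase z (sibuyaL ϑ z * Complex.exp (0 * Complex.I)) ∈ Complex.slitPlane := by
    rw [h0]; exact hz.mem_slitPlane
  have hev := hc.continuousAt.eventually_mem (Complex.isOpen_slitPlane.mem_nhds hm)
  have hev2 := hev.mono fun w hw => (hasDerivAt_saddleExponent (ϑ := ϑ) hw).deriv
  rw [Filter.EventuallyEq.deriv_eq hev2]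
  have hx := hasDerivAt_mul_exp_mul_I (sibuyaL ϑ z) 0
  have hF := (hasDerivAt_stirlingBase z _).comp (0 : ℂ) hx
  have hN := ((hx.cexp).const_mul (Complex.exp z)).mul (hx.mul_const Complex.I)
  have hQ := ((hN.div hF (Complex.slitPlane_ne_zero hm)).const_mul (ϑ : ℂ)).sub_const Complex.I
  refine (HasDerivAt.deriv hQ).trans ?_
  simp only [Function.comp_apply, Pi.mul_apply]
  rw [h0, stirlingBase_eq_of_eqn hz.eqn]
  have h1 := Complex.exp_ne_zero z
  have h2 := Complex.exp_ne_zero (sibuyaL ϑ z)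
  have h3 := hz.ne_zero
  have h4 : (ϑ : ℂ) ≠ 0 := by exact_mod_cast hϑ.ne'
  have hI : Complex.I ^ 2 = -1 := Complex.I_sq
  field_simp
  rw [hI]
  ring

theorem IsRegularPoint.integrand_eq {ϑ : ℝ} {z w : ℂ} (hz : IsRegularPoint ϑ z) (n : ℕ)
    (h : stirlingBase z (sibuyaL ϑ z * Complex.exp (w * Complex.I)) ∈ Complex.slitPlane) :
    stirlingBase z (sibuyaL ϑ z * Complex.exp (w * Complex.I)) ^ ((ϑ * n : ℝ) : ℂ) /
      Complex.exp (w * Complex.I) ^ n =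
    stirlingBase z (sibuyaL ϑ z) ^ ((ϑ * n : ℝ) : ℂ) *
      Complex.exp ((n : ℝ) * saddleExponent ϑ z w) := by
  rw [Complex.cpow_def_of_ne_zero (Complex.slitPlane_ne_zero h),
    Complex.cpow_def_of_ne_zero (Complex.slitPlane_ne_zero hz.mem_slitPlane), ← Complex.exp_nat_mul,
    ← Complex.exp_sub, ← Complex.exp_add]
  congr 1
  unfold saddleExponent
  push_cast
  ring

/-- Joint continuity at `(t, 0)` supplies one radius `R` for all `z` near `t`; the bound `1` is the
constant `M` of `laplace_uniform`. -/
theorem IsSaddle.eventually_saddleExponent_bound {ϑ t r : ℝ} (h : IsSaddle ϑ t r) (hϑ : 0 < ϑ)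
    {δ : ℝ} (hδ : 0 < δ) : ∃ R, 0 < R ∧ R ≤ δ ∧ ∀ᶠ z in 𝓝 (t : ℂ), ∀ w ∈ Metric.ball (0 : ℂ) R,
      stirlingBase z (sibuyaL ϑ z * Complex.exp (w * Complex.I)) ∈ Complex.slitPlane ∧
        ‖saddleExponent ϑ z w‖ ≤ 1 := by
  have hL := (h.analyticAt_sibuyaL hϑ).continuousAt
  have hr := h.sibuyaL_eq hϑ
  obtain ⟨F, hF0, hFe⟩ := h.stirlingBase_pos hϑ
  have h1 : Tendsto (fun p : ℂ × ℂ => p.1) (𝓝 ((t : ℂ), (0 : ℂ))) (𝓝 (t : ℂ)) :=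
    continuousAt_fst
  have hL2 : ContinuousAt (fun p : ℂ × ℂ => sibuyaL ϑ p.1) ((t : ℂ), (0 : ℂ)) :=
    ContinuousAt.comp (f := Prod.fst) (g := sibuyaL ϑ) hL continuousAt_fst
  have hG : ContinuousAt (fun p : ℂ × ℂ => stirlingBase p.1 (sibuyaL ϑ p.1)) ((t : ℂ), (0 : ℂ)) :=
    continuous_stirlingBase.continuousAt.comp (continuousAt_fst.prodMk hL2)
  have hH : ContinuousAt (fun p : ℂ × ℂ =>
      stirlingBase p.1 (sibuyaL ϑ p.1 * Complex.exp (p.2 * Complex.I))) ((t : ℂ), (0 : ℂ)) :=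
    continuous_stirlingBase.continuousAt.comp (continuousAt_fst.prodMk (hL2.mul (by fun_prop)))
  have hsl : stirlingBase t (sibuyaL ϑ t) ∈ Complex.slitPlane := by
    rw [hr, hFe]; exact Complex.ofReal_mem_slitPlane.2 hF0
  have hsl2 : stirlingBase t (sibuyaL ϑ t * Complex.exp (0 * Complex.I)) ∈ Complex.slitPlane := by
    simpa using hsl
  have hE : ContinuousAt (fun p : ℂ × ℂ => saddleExponent ϑ p.1 p.2) ((t : ℂ), (0 : ℂ)) :=
    (continuousAt_const.mul ((hH.clog hsl2).sub (hG.clog hsl))).sub (by fun_prop)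
  have e1 := hH.eventually_mem (Complex.isOpen_slitPlane.mem_nhds hsl2)
  have e2 := hE.norm.eventually_lt (continuousAt_const (y := (1 : ℝ)))
    (by simp [saddleExponent_zero])
  have e3 := e1.and e2
  rw [nhds_prod_eq] at e3
  obtain ⟨pa, ha, pb, hb, hab⟩ := eventually_prod_iff.1 e3
  obtain ⟨R, hR, hRb⟩ := Metric.eventually_nhds_iff_ball.1 hb
  refine ⟨min R δ, lt_min hR hδ, min_le_right _ _, ?_⟩
  filter_upwards [ha] with z hz w hw
  have := hab hz (hRb w (Metric.ball_subset_ball (min_le_left _ _) hw))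
  exact ⟨this.1, this.2.le⟩

/-! ### Local asymptotics near a real point -/

theorem exists_pow_le_div_mul_sqrt {η : ℝ} (h0 : 0 ≤ η) (h1 : η < 1) :
    ∃ C : ℝ, 0 ≤ C ∧ ∀ n : ℕ, 1 ≤ n → η ^ n ≤ C / (n * √n) := by
  have h2 := (tendsto_pow_const_mul_const_pow_of_abs_lt_one 2
    (by rwa [abs_of_nonneg h0] : |η| < 1)).bddAbove_range
  obtain ⟨C, hC⟩ := h2
  have hC' : ∀ n : ℕ, (n : ℝ) ^ 2 * η ^ n ≤ C := fun n => hC ⟨n, rfl⟩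
  refine ⟨C, le_trans (by simp) (hC' 0), fun n hn => ?_⟩
  have hn1 : (1 : ℝ) ≤ n := by exact_mod_cast hn
  have hs : √(n : ℝ) ≤ n := Real.sqrt_le_iff.2 ⟨by linarith, by nlinarith⟩
  have hpos : 0 < (n : ℝ) * √n := by positivity
  rw [le_div_iff₀ hpos]
  refine le_trans ?_ (hC' n)
  have : (n : ℝ) * √n ≤ n ^ 2 := by rw [sq]; gcongr
  rw [mul_comm]
  exact mul_le_mul_of_nonneg_right this (pow_nonneg h0 n)

/-- Here `J = n! e^n / n^n = j √(2πn)` with `1 ≤ j ≤ 1 + 1/n`, so `J/(2π) · √(2π/n) = j`: the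
Gaussian factor cancels, and `J ~ √n` turns the error `n^{-3/2}` into `1/n`. -/
theorem norm_stirling_mul_sub_le {J C M : ℝ} {n : ℕ} (hn : 1 ≤ n) {I Ψ : ℂ}
    (h1 : 1 ≤ J / √(2 * Real.pi * n)) (h2 : J / √(2 * Real.pi * n) ≤ 1 + 1 / n)
    (hI : ‖2 * Real.pi * I - (√(2 * Real.pi / n) : ℝ) * Ψ‖ ≤ C / (n * √n)) (hΨ : ‖Ψ‖ ≤ M) :
    ‖(J : ℂ) * I - Ψ‖ ≤ (√(2 * Real.pi) / Real.pi * C + M) / n := by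
  have hn1 : (1 : ℝ) ≤ n := by exact_mod_cast hn
  have hn0 : (0 : ℝ) < n := by linarith
  have hpi := Real.pi_pos
  set j := J / √(2 * Real.pi * n) with hj
  have hJ : J = j * (√(2 * Real.pi) * √n) := by
    rw [← Real.sqrt_mul (by positivity), hj, div_mul_cancel₀]
    positivity
  have hsq : √(2 * Real.pi / n) = √(2 * Real.pi) / √n := Real.sqrt_div' _ hn0.le
  have hsn : 0 < √(n : ℝ) := Real.sqrt_pos.2 hn0
  have hs2 : √(2 * Real.pi) * √(2 * Real.pi) = 2 * Real.pi := Real.mul_self_sqrt (by positivity)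
  have hj2 : j ≤ 2 := by
    have : 1 / (n : ℝ) ≤ 1 := by rw [div_le_one hn0]; exact hn1
    linarith
  have hJ0 : 0 ≤ J := by rw [hJ]; positivity
  have hone : J / (2 * Real.pi) * √(2 * Real.pi / n) = j := by
    rw [hJ, hsq]
    field_simp
    linear_combination hs2
  have hone' : ((J / (2 * Real.pi) : ℝ) : ℂ) * (√(2 * Real.pi / n) : ℝ) = (j : ℂ) := by
    rw [← Complex.ofReal_mul, hone]
  have e : (J : ℂ) * I - Ψ = ((J / (2 * Real.pi) : ℝ) : ℂ) *
      (2 * Real.pi * I - (√(2 * Real.pi / n) : ℝ) * Ψ) + ((j - 1 : ℝ) : ℂ) * Ψ := by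
    have : ((J / (2 * Real.pi) : ℝ) : ℂ) * (2 * Real.pi) = J := by
      have : (Real.pi : ℂ) ≠ 0 := by exact_mod_cast hpi.ne'
      push_cast; field_simp
    rw [Complex.ofReal_sub, Complex.ofReal_one]
    linear_combination -I * this + Ψ * hone'
  rw [e]
  refine (norm_add_le _ _).trans ?_
  rw [norm_mul, norm_mul, Complex.norm_real, Complex.norm_real, Real.norm_of_nonneg (by positivity),
    Real.norm_of_nonneg (by linarith), add_div]
  have hC : 0 ≤ C / (n * √n) := (norm_nonneg _).trans hI
  refine add_le_add ?_ ?_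
  · calc J / (2 * Real.pi) * ‖2 * Real.pi * I - (√(2 * Real.pi / n) : ℝ) * Ψ‖
        ≤ (2 * (√(2 * Real.pi) * √n)) / (2 * Real.pi) * (C / (n * √n)) := by
          rw [hJ]; gcongr
      _ = _ := by field_simp
  · calc (j - 1) * ‖Ψ‖ ≤ 1 / n * M := by
          have : j - 1 ≤ 1 / n := by linarith
          gcongr
      _ = M / n := by ring

/-- The branch of `F^θ` that occurs in the integrand is the principal one on the whole region
between the circle of radius `e^{-B}` and the polygonal contour. -/
def SlitCondition (α₁ B : ℝ) (z L : ℂ) : Prop :=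
  (∀ w ∈ Set.Icc (-α₁) α₁ ×ℂ Set.Icc 0 B,
    stirlingBase z (L * Complex.exp (w * Complex.I)) ∈ Complex.slitPlane) ∧
  ∀ y ∈ Metric.closedBall (0 : ℂ) (Real.exp (-B)), stirlingBase z (L * y) ∈ Complex.slitPlane

theorem eventually_slitCondition {α₁ B : ℝ} {L : ℂ → ℂ} {t : ℂ} (hL : ContinuousAt L t)
    (h : SlitCondition α₁ B t (L t)) : ∀ᶠ z in 𝓝 t, SlitCondition α₁ B z (L z) := by
  have hL2 : ∀ w : ℂ, ContinuousAt (fun p : ℂ × ℂ => L p.1) (t, w) := fun w =>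
    ContinuousAt.comp (f := Prod.fst) (g := L) hL continuousAt_fst
  refine Eventually.and ?_ ?_
  · refine (isCompact_Icc.reProdIm isCompact_Icc).eventually_forall_of_forall_eventually
      fun w hw => ?_
    have hH : ContinuousAt (fun p : ℂ × ℂ =>
        stirlingBase p.1 (L p.1 * Complex.exp (p.2 * Complex.I))) (t, w) :=
      continuous_stirlingBase.continuousAt.comp
        (continuousAt_fst.prodMk ((hL2 w).mul (by fun_prop)))
    exact hH.eventually_mem (Complex.isOpen_slitPlane.mem_nhds (h.1 w hw))
  · refine (isCompact_closedBall _ _).eventually_forall_of_forall_eventually fun w hw => ?_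
    have hH : ContinuousAt (fun p : ℂ × ℂ => stirlingBase p.1 (L p.1 * p.2)) (t, w) :=
      continuous_stirlingBase.continuousAt.comp (continuousAt_fst.prodMk ((hL2 w).mul (by fun_prop)))
    exact hH.eventually_mem (Complex.isOpen_slitPlane.mem_nhds (h.2 w hw))

/-- The `n`-th root of the modulus of the normalized integrand. -/
noncomputable def integrandRatio (ϑ : ℝ) (L : ℂ → ℂ) (z w : ℂ) : ℝ :=
  ‖stirlingBase z (L z * Complex.exp (w * Complex.I))‖ ^ ϑ * Real.exp w.im /
    ‖stirlingBase z (L z)‖ ^ ϑ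

/-- Compactness turns the strict inequality at `t` into a ratio `η < 1`, and the tube lemma
transfers it to nearby `z`. -/
theorem eventually_integrandRatio_le {ϑ : ℝ} (hϑ : 0 < ϑ) {L : ℂ → ℂ} {t : ℂ}
    (hL : ContinuousAt L t) (hF : stirlingBase t (L t) ≠ 0) {E : Set ℂ} (hE : IsCompact E)
    (h : ∀ w ∈ E, integrandRatio ϑ L t w < 1) :
    ∃ η : ℝ, 0 ≤ η ∧ η < 1 ∧ ∀ᶠ z in 𝓝 t, ∀ w ∈ E, integrandRatio ϑ L z w ≤ η := by
  have hcont : ∀ w, ContinuousAt (fun p : ℂ × ℂ => integrandRatio ϑ L p.1 p.2) (t, w) := by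
    intro w
    have hL2 : ContinuousAt (fun p : ℂ × ℂ => L p.1) (t, w) :=
      ContinuousAt.comp (f := Prod.fst) (g := L) hL continuousAt_fst
    have hG : ContinuousAt (fun p : ℂ × ℂ => stirlingBase p.1 (L p.1)) (t, w) :=
      continuous_stirlingBase.continuousAt.comp (continuousAt_fst.prodMk hL2)
    have hH : ContinuousAt (fun p : ℂ × ℂ =>
        stirlingBase p.1 (L p.1 * Complex.exp (p.2 * Complex.I))) (t, w) :=
      continuous_stirlingBase.continuousAt.comp (continuousAt_fst.prodMk (hL2.mul (by fun_prop)))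
    refine ((hH.norm.rpow_const (Or.inr hϑ.le)).mul (by fun_prop)).div
      (hG.norm.rpow_const (Or.inr hϑ.le)) ?_
    exact (Real.rpow_pos_of_pos (norm_pos_iff.2 hF) ϑ).ne'
  obtain ⟨η, h0, h1, hη⟩ : ∃ η : ℝ, 0 ≤ η ∧ η < 1 ∧ ∀ w ∈ E, integrandRatio ϑ L t w < η := by
    rcases E.eq_empty_or_nonempty with rfl | hne
    · exact ⟨0, le_rfl, one_pos, by simp⟩
    · have hc : ContinuousOn (integrandRatio ϑ L t) E := fun w _ =>
        ((hcont w).comp (f := fun w => (t, w)) (by fun_prop)).continuousWithinAt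
      obtain ⟨w₀, hw₀, hmax⟩ := hE.exists_isMaxOn hne hc
      have h2 := h w₀ hw₀
      have h3 : 0 ≤ integrandRatio ϑ L t w₀ := by unfold integrandRatio; positivity
      refine ⟨(1 + integrandRatio ϑ L t w₀) / 2, by linarith, by linarith, fun w hw => ?_⟩
      have : integrandRatio ϑ L t w ≤ integrandRatio ϑ L t w₀ := hmax hw
      linarith
  refine ⟨η, h0, h1, ?_⟩
  refine (hE.eventually_forall_of_forall_eventually
    (P := fun z w => integrandRatio ϑ L z w < η) fun w hw => (hcont w).eventually_lt (continuousAt_const (y := η)) (hη w hw)).mono fun z hz w hw => ?_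
  exact (hz w hw).le

theorem norm_integrand_eq {ϑ : ℝ} {L : ℂ → ℂ} {z : ℂ} (hF : stirlingBase z (L z) ≠ 0)
    (n : ℕ) (w : ℂ) :
    ‖stirlingBase z (L z * Complex.exp (w * Complex.I)) ^ ((ϑ * n : ℝ) : ℂ) /
      Complex.exp (w * Complex.I) ^ n‖ =
    integrandRatio ϑ L z w ^ n * ‖stirlingBase z (L z) ^ ((ϑ * n : ℝ) : ℂ)‖ := by
  have h1 : 0 < ‖stirlingBase z (L z)‖ ^ ϑ := Real.rpow_pos_of_pos (norm_pos_iff.2 hF) ϑ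
  have h2 : ‖Complex.exp (w * Complex.I)‖ = (Real.exp w.im)⁻¹ := by
    rw [Complex.norm_exp, ← Real.exp_neg]; simp
  rw [norm_div, norm_pow, h2, Complex.norm_cpow_real, Complex.norm_cpow_real,
    Real.rpow_mul_natCast (norm_nonneg _), Real.rpow_mul_natCast (norm_nonneg _), integrandRatio,
    div_pow, mul_pow, inv_pow]
  have := Real.exp_pos w.im
  field_simp

theorem differentiableAt_stirlingBase_cpow {z L θ y : ℂ}
    (h : stirlingBase z (L * y) ∈ Complex.slitPlane ∨ ∃ m : ℕ, θ = m) :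
    DifferentiableAt ℂ (fun y => stirlingBase z (L * y) ^ θ) y := by
  have hd := (hasDerivAt_stirlingBase_mul z L y).differentiableAt
  rcases h with h | ⟨m, rfl⟩
  · exact hd.cpow_const h
  · simp only [Complex.cpow_natCast]
    exact hd.pow m

/-- The alternative in the hypotheses is what makes the power holomorphic inside the contour: either
the base avoids the cut, or the exponent is a natural number. The constant and the neighbourhood do
not depend on `n`. -/
theorem IsSaddle.local_asymptotics {ϑ t r α₁ B : ℝ} (h : IsSaddle ϑ t r) (hϑ : 0 < ϑ)
    (hα0 : 0 < α₁) (hα : α₁ ≤ Real.pi) (hB : 0 ≤ B)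
    (hE : ∀ a > 0, ∀ w ∈ contourEdges a α₁ B, integrandRatio ϑ (sibuyaL ϑ) t w < 1) :
    ∃ C, ∀ᶠ z in 𝓝 (t : ℂ), ∀ n : ℕ, StirlingSibuyaAdmissible n (ϑ * n) →
      (SlitCondition α₁ B t (sibuyaL ϑ t) ∨ ∃ m : ℕ, ϑ * n = m) →
      ‖normalizedLaplace (stirlingSibuya n (ϑ * n)) n (sibuyaPhi ϑ) z - sibuyaPsi ϑ z‖ ≤ C / n := by
  have hL := (h.analyticAt_sibuyaL hϑ).continuousAt
  have hreg := h.eventually_isRegularPoint hϑ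
  obtain ⟨R, hR, hRα, hRe⟩ := h.eventually_saddleExponent_bound hϑ hα0
  set s : ℂ → ℂ := fun z => (ϑ * sibuyaL ϑ z + ϑ - 1) / ϑ with hs
  have hsc : ContinuousAt (fun z => (s z).re) (t : ℂ) :=
    Complex.continuous_re.continuousAt.comp
      ((((continuousAt_const.mul hL).add continuousAt_const).sub continuousAt_const).div
        continuousAt_const (by exact_mod_cast hϑ.ne'))
  have hst : (s t).re = (ϑ * r + ϑ - 1) / ϑ := by
    have : s t = (((ϑ * r + ϑ - 1) / ϑ : ℝ) : ℂ) := by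
      simp only [hs, h.sibuyaL_eq hϑ]; push_cast; rfl
    rw [this, Complex.ofReal_re]
  have hst0 : 0 < (ϑ * r + ϑ - 1) / ϑ := div_pos h.pos' hϑ
  set c := (ϑ * r + ϑ - 1) / ϑ / 2 with hc
  have hc0 : 0 < c := by positivity
  have hsev : ∀ᶠ z in 𝓝 (t : ℂ), c < (s z).re :=
    (continuousAt_const (y := c)).eventually_lt hsc (by rw [hst]; linarith)
  obtain ⟨a, ha0, haR, C₁, hC₁⟩ := laplace_uniform hR zero_le_one hc0
  have haα : a ≤ α₁ := by linarith
  -- The decay rate is chosen after `a`, since the edges start at distance `a` from the saddle.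
  obtain ⟨η, hη0, hη1, hηe⟩ := eventually_integrandRatio_le hϑ hL
    (Complex.slitPlane_ne_zero hreg.self_of_nhds.mem_slitPlane) (isCompact_contourEdges hα hB)
    (hE a ha0)
  obtain ⟨C₂, hC₂0, hC₂⟩ := exists_pow_le_div_mul_sqrt hη0 hη1
  -- Stated as an implication so that one neighbourhood also serves the integral exponents, for
  -- which the slit condition may fail.
  have hSev : ∀ᶠ z in 𝓝 (t : ℂ), SlitCondition α₁ B t (sibuyaL ϑ t) →
      SlitCondition α₁ B z (sibuyaL ϑ z) := by
    by_cases hS : SlitCondition α₁ B t (sibuyaL ϑ t)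
    · exact (eventually_slitCondition hL hS).mono fun z hz _ => hz
    · exact Eventually.of_forall fun z hz => absurd hz hS
  have hΨ : ∀ᶠ z in 𝓝 (t : ℂ), ‖sibuyaPsi ϑ z‖ < ‖sibuyaPsi ϑ t‖ + 1 :=
    (h.analyticAt_sibuyaPsi hϑ).continuousAt.norm.eventually_lt continuousAt_const (by linarith)
  refine ⟨√(2 * Real.pi) / Real.pi * (C₁ + (2 * Real.pi + 2 * B) * C₂) +
    (‖sibuyaPsi ϑ t‖ + 1), ?_⟩
  filter_upwards [hreg, hRe, hsev, hηe, hSev, hΨ] with z hz hzR hzs hzη hzS hzΨ n hn hcase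
  have hF := Complex.slitPlane_ne_zero hz.mem_slitPlane
  set P := stirlingBase z (sibuyaL ϑ z) ^ ((ϑ * n : ℝ) : ℂ) with hP
  have hP0 : P ≠ 0 := by
    rw [hP, Complex.cpow_def_of_ne_zero hF]; exact Complex.exp_ne_zero _
  have hcase' : SlitCondition α₁ B z (sibuyaL ϑ z) ∨ ∃ m : ℕ, ((ϑ * n : ℝ) : ℂ) = m := by
    rcases hcase with h1 | ⟨m, hm⟩
    · exact Or.inl (hzS h1)
    · exact Or.inr ⟨m, by rw [hm]; simp⟩
  have hcont := norm_contour_sub_le (f := fun y => stirlingBase z (sibuyaL ϑ z * y) ^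
      ((ϑ * n : ℝ) : ℂ)) (n := n) (m := η ^ n * ‖P‖) ha0 haα hα hB
    (fun y hy => (differentiableAt_stirlingBase_cpow
      (hcase'.imp_left fun h => h.2 y hy)).differentiableWithinAt)
    (fun w hw => differentiableAt_stirlingBase_cpow (hcase'.imp_left fun h => h.1 w hw))
    (fun w hw => by
      rw [norm_integrand_eq hF]
      refine mul_le_mul_of_nonneg_right (pow_le_pow_left₀ ?_ (hzη w hw) n) (norm_nonneg _)
      unfold integrandRatio; positivity)
  have hint : ∫ x in (-a)..a, stirlingBase z (sibuyaL ϑ z * Complex.exp ((x : ℂ) * Complex.I)) ^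
      ((ϑ * n : ℝ) : ℂ) / Complex.exp ((x : ℂ) * Complex.I) ^ n =
      P * ∫ x in (-a)..a, Complex.exp ((n : ℝ) * saddleExponent ϑ z x) := by
    rw [← intervalIntegral.integral_const_mul]
    refine intervalIntegral.integral_congr fun x hx => ?_
    rw [Set.uIcc_of_le (by linarith)] at hx
    refine hz.integrand_eq n (hzR x ?_).1
    rw [mem_ball_zero_iff, Complex.norm_real, Real.norm_eq_abs]
    have := abs_le.2 hx
    linarith
  rw [hint] at hcont
  set D := iteratedDeriv n (fun y => stirlingBase z (sibuyaL ϑ z * y) ^ ((ϑ * n : ℝ) : ℂ)) 0 with hD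
  set Y := ∫ x in (-a)..a, Complex.exp ((n : ℝ) * saddleExponent ϑ z x) with hY
  have hn1 : 1 ≤ n := hn.1
  have hn0 : (0 : ℝ) < n := by exact_mod_cast hn1
  have h1 : ‖2 * Real.pi * (D / n.factorial / P) - Y‖ ≤ (2 * Real.pi + 2 * B) * η ^ n := by
    have hPn : 0 < ‖P‖ := norm_pos_iff.2 hP0
    have e : 2 * Real.pi * (D / n.factorial / P) - Y =
        (2 * Real.pi / n.factorial * D - P * Y) / P := by
      field_simp
    rw [e, norm_div, div_le_iff₀ hPn, mul_assoc]
    exact hcont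
  have h2 := hC₁ (saddleExponent ϑ z) (s z)
    (fun w hw => (hasDerivAt_saddleExponent (hzR w hw).1).differentiableAt.differentiableWithinAt)
    (fun w hw => (hzR w hw).2) (saddleExponent_zero ϑ z) (hz.deriv_saddleExponent hϑ)
    (hz.deriv_deriv_saddleExponent hϑ) hzs.le n hn0
  have hψ : (1 / s z) ^ (1 / 2 : ℂ) = sibuyaPsi ϑ z := by
    simp only [hs, sibuyaPsi, one_div_div]
  rw [hψ] at h2
  have h3 : ‖2 * Real.pi * (D / n.factorial / P) - (√(2 * Real.pi / n) : ℝ) * sibuyaPsi ϑ z‖ ≤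
      (C₁ + (2 * Real.pi + 2 * B) * C₂) / (n * √n) := by
    have hpb : 0 ≤ 2 * Real.pi + 2 * B := by positivity
    calc _ ≤ ‖2 * Real.pi * (D / n.factorial / P) - Y‖ +
          ‖Y - (√(2 * Real.pi / n) : ℝ) * sibuyaPsi ϑ z‖ := norm_sub_le_norm_sub_add_norm_sub _ _ _
      _ ≤ (2 * Real.pi + 2 * B) * (C₂ / (n * √n)) + C₁ / (n * √n) :=
          add_le_add (h1.trans (mul_le_mul_of_nonneg_left (hC₂ n hn1) hpb)) h2
      _ = _ := by ring
  rw [hz.normalizedLaplace_eq hϑ hn]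
  have hst := factorial_stirling_bounds n hn1
  exact norm_stirling_mul_sub_le hn1 hst.1 hst.2 h3 hzΨ.le

/-! ### Decay along the contour -/

/-- Strictness already comes from the first two terms, `|x + x²/2| = |x| |1 + x/2|`; the remaining
series is bounded termwise. -/
theorem norm_exp_sub_one_lt {x : ℂ} (hx : x ≠ (‖x‖ : ℝ)) :
    ‖Complex.exp x - 1‖ < Real.exp ‖x‖ - 1 := by
  set r := ‖x‖ with hr
  have hsq : x.re ^ 2 + x.im ^ 2 = r ^ 2 := by
    rw [hr, ← Complex.normSq_eq_norm_sq, Complex.normSq_apply]; ring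
  have hre : x.re < r := by
    refine lt_of_le_of_ne (Complex.re_le_norm x) fun h => hx ?_
    rw [h] at hsq
    have : x.im = 0 := by
      have : x.im ^ 2 = 0 := by linarith
      exact pow_eq_zero_iff two_ne_zero |>.1 this
    exact Complex.ext (by simpa using h) (by simpa using this)
  have hr0 : 0 < r := by
    refine lt_of_le_of_ne (norm_nonneg x) fun h => ?_
    have : x.re = 0 := by
      have h1 : x.re ^ 2 ≤ 0 := by rw [← h] at hsq; nlinarith [sq_nonneg x.im]
      exact pow_eq_zero_iff two_ne_zero |>.1 (le_antisymm h1 (sq_nonneg _))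
    linarith
  have h1 := Complex.norm_exp_sub_sum_le_exp_norm_sub_sum x 3
  simp only [Finset.sum_range_succ, Finset.sum_range_zero, pow_zero, Nat.factorial, pow_one,
    Nat.cast_one, div_one, zero_add, mul_one] at h1
  norm_num at h1
  rw [← hr] at h1
  have h2 : ‖1 + x / 2‖ < 1 + r / 2 := by
    refine lt_of_pow_lt_pow_left₀ 2 (by linarith) ?_
    rw [← Complex.normSq_eq_norm_sq, Complex.normSq_apply]
    simp only [Complex.add_re, Complex.one_re, Complex.div_ofNat_re, Complex.add_im, Complex.one_im,
      Complex.div_ofNat_im]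
    nlinarith
  have h3 : ‖x + x ^ 2 / 2‖ < r + r ^ 2 / 2 := by
    have : x + x ^ 2 / 2 = x * (1 + x / 2) := by ring
    rw [this, norm_mul, ← hr]
    have := mul_lt_mul_of_pos_left h2 hr0
    linarith
  have e : Complex.exp x - 1 = (Complex.exp x - (1 + x + x ^ 2 / 2)) + (x + x ^ 2 / 2) := by ring
  rw [e]
  refine (norm_add_le _ _).trans_lt ?_
  linarith

theorem stirlingBase_ofReal (t p : ℝ) :
    stirlingBase t p = ((1 + Real.exp t * (Real.exp p - 1) : ℝ) : ℂ) := by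
  unfold stirlingBase; push_cast; rfl

theorem norm_stirlingBase_lt (t : ℝ) {x : ℂ} (hx : x ≠ (‖x‖ : ℝ)) :
    ‖stirlingBase t x‖ < 1 + Real.exp t * (Real.exp ‖x‖ - 1) := by
  unfold stirlingBase
  refine (norm_add_le _ _).trans_lt ?_
  rw [norm_one, norm_mul, ← Complex.ofReal_exp, Complex.norm_real,
    Real.norm_of_nonneg (Real.exp_pos t).le]
  have := mul_lt_mul_of_pos_left (norm_exp_sub_one_lt hx) (Real.exp_pos t)
  linarith

theorem norm_ofReal_mul_exp_mul_I {r : ℝ} (hr : 0 ≤ r) (w : ℂ) :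
    ‖(r : ℂ) * Complex.exp (w * Complex.I)‖ = r * Real.exp (-w.im) := by
  rw [norm_mul, Complex.norm_real, Real.norm_of_nonneg hr, Complex.norm_exp]
  simp

theorem norm_stirlingBase_ofReal {t r : ℝ} (hr : 0 < r) :
    ‖stirlingBase t r‖ = 1 + Real.exp t * (Real.exp r - 1) := by
  have : 0 ≤ Real.exp t * (Real.exp r - 1) :=
    mul_nonneg (Real.exp_pos t).le (by linarith [Real.add_one_le_exp r])
  rw [stirlingBase_ofReal, Complex.norm_real, Real.norm_of_nonneg (by linarith)]

theorem integrandRatio_lt_one_of_im_eq_zero {ϑ t r : ℝ} (hϑ : 0 < ϑ) (hr : 0 < r) {L : ℂ → ℂ}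
    (hL : L t = r) {w : ℂ} (hw : w.im = 0) (h0 : 0 < |w.re|) (hpi : |w.re| ≤ Real.pi) :
    integrandRatio ϑ L t w < 1 := by
  have hn : ‖(r : ℂ) * Complex.exp (w * Complex.I)‖ = r := by
    rw [norm_ofReal_mul_exp_mul_I hr.le, hw]; simp
  have hne : (r : ℂ) * Complex.exp (w * Complex.I) ≠
      (‖(r : ℂ) * Complex.exp (w * Complex.I)‖ : ℝ) := by
    rw [hn]
    intro h
    have hr' : (r : ℂ) ≠ 0 := by exact_mod_cast hr.ne'
    have h1 := mul_left_cancel₀ hr' (h.trans (mul_one _).symm)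
    -- Equality would force `e^{iw} = 1`, hence `cos (Re w) = 1`, which `0 < |Re w| ≤ π` excludes.
    have h2 := congrArg Complex.re h1
    rw [Complex.exp_re] at h2
    simp [hw] at h2
    have h3 := (Real.cos_eq_one_iff_of_lt_of_lt
      (by linarith [neg_abs_le w.re, Real.pi_pos]) (by linarith [le_abs_self w.re, Real.pi_pos])).1 h2
    simp [h3] at h0
  have h1 := norm_stirlingBase_lt t hne
  rw [hn, ← norm_stirlingBase_ofReal hr] at h1
  have h2 : 0 < ‖stirlingBase t r‖ := (norm_nonneg _).trans_lt h1
  rw [integrandRatio, hL, hw, Real.exp_zero, mul_one, div_lt_one (Real.rpow_pos_of_pos h2 ϑ)]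
  exact Real.rpow_lt_rpow (norm_nonneg _) h1 hϑ

theorem integrandRatio_lt_one_of_mem_contourEdges_pi_zero {ϑ t r : ℝ} (hϑ : 0 < ϑ) (hr : 0 < r)
    {L : ℂ → ℂ} (hL : L t = r) {a : ℝ} (ha : 0 < a) {w : ℂ} (hw : w ∈ contourEdges a Real.pi 0) :
    integrandRatio ϑ L t w < 1 := by
  rcases hw with (⟨h1, h2⟩ | ⟨h1, h2⟩) | ⟨h1, h2⟩
  · exact integrandRatio_lt_one_of_im_eq_zero hϑ hr hL (le_antisymm h2.2 h2.1)
      (by rw [h1]; exact Real.pi_pos) h1.le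
  · exact integrandRatio_lt_one_of_im_eq_zero hϑ hr hL h2 (Real.pi_pos.trans_le h1.1) h1.2
  · exact integrandRatio_lt_one_of_im_eq_zero hϑ hr hL h2 (ha.trans_le h1.1) h1.2

/-- The base is real only if `sin (Im x) = 0`. Off the real axis this forces `r ≥ π`, and then `ϑr -
1 > 1`, so by the saddle equation `1 - e^t = e^t (ϑr - 1) e^r` exceeds `e^{t + r}` and the base is
positive. Only the real axis can meet the cut. -/
theorem stirlingBase_mem_slitPlane {ϑ t r : ℝ} (h : IsSaddle ϑ t r) (hϑ : 1 ≤ ϑ) {x : ℂ}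
    (hx : ‖x‖ ≤ r) (h0 : x.im = 0 → 0 < 1 + Real.exp t * (Real.exp x.re - 1)) :
    stirlingBase t x ∈ Complex.slitPlane := by
  have hre : (stirlingBase t x).re = 1 + Real.exp t * (Real.exp x.re * Real.cos x.im - 1) := by
    simp [stirlingBase, ← Complex.ofReal_exp, Complex.exp_re]
  have him : (stirlingBase t x).im = Real.exp t * (Real.exp x.re * Real.sin x.im) := by
    simp [stirlingBase, ← Complex.ofReal_exp, Complex.exp_im]
  rw [Complex.mem_slitPlane_iff, hre, him]
  by_cases hs : Real.sin x.im = 0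
  · left
    by_cases hi : x.im = 0
    · simpa [hi] using h0 hi
    · have hpi : Real.pi ≤ |x.im| := by
        by_contra hc
        push Not at hc
        have := abs_lt.1 hc
        exact hi ((Real.sin_eq_zero_iff_of_lt_of_lt this.1 this.2).1 hs)
      have hrpi : Real.pi ≤ r := hpi.trans ((Complex.abs_im_le_norm x).trans hx)
      have hp : x.re ≤ r := (Complex.re_le_norm x).trans hx
      have h3 := Real.pi_gt_three
      have e1 : Real.exp t * Real.exp (-t) = 1 := by rw [← Real.exp_add]; simp
      have e2 : 1 - Real.exp t = Real.exp t * ((ϑ * r - 1) * Real.exp r) := by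
        rw [h.eqn]; linear_combination -e1
      have e3 : Real.exp x.re ≤ Real.exp r := Real.exp_le_exp.2 hp
      have e4 : -Real.exp x.re ≤ Real.exp x.re * Real.cos x.im := by
        nlinarith [Real.neg_one_le_cos x.im, Real.exp_pos x.re]
      have e5 : Real.exp r < (ϑ * r - 1) * Real.exp r := by
        have : 1 < ϑ * r - 1 := by nlinarith
        nlinarith [Real.exp_pos r]
      have e6 : 0 < Real.exp t * ((ϑ * r - 1) * Real.exp r + Real.exp x.re * Real.cos x.im) :=
        mul_pos (Real.exp_pos t) (by linarith)
      linarith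
  · right
    exact mul_ne_zero (Real.exp_pos t).ne' (mul_ne_zero (Real.exp_pos _).ne' hs)

theorem stirlingBase_pos_of_lt {t δ p : ℝ} (hδ : 0 ≤ 1 + Real.exp t * (Real.exp (-δ) - 1))
    (hp : -δ < p) : 0 < 1 + Real.exp t * (Real.exp p - 1) := by
  have := mul_lt_mul_of_pos_left (Real.exp_lt_exp.2 hp) (Real.exp_pos t)
  linarith

theorem integrandRatio_neg_conj {ϑ t r : ℝ} {L : ℂ → ℂ} (hL : L t = r) (w : ℂ) :
    integrandRatio ϑ L t (-(starRingEnd ℂ) w) = integrandRatio ϑ L t w := by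
  have h1 : stirlingBase t (L t * Complex.exp (-(starRingEnd ℂ) w * Complex.I)) =
      (starRingEnd ℂ) (stirlingBase t (L t * Complex.exp (w * Complex.I))) := by
    simp only [stirlingBase, hL, map_add, map_mul, map_sub, map_one, ← Complex.exp_conj,
      Complex.conj_ofReal, Complex.conj_I]
    ring_nf
  rw [integrandRatio, integrandRatio, h1, RCLike.norm_conj]
  simp

/-- Since the base vanishes at `-δ`, it equals `(e^t - 1)(e^{p + δ} - 1)` at real `p`. With `s = r
e^{-b}`, the quotient of the moduli at `-s` and `r` is at most `(s - δ)/(r + δ) < s/r = e^{-b}`.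
Raising it to a power `ϑ ≥ 1` does not increase it, so the factor `e^b` is compensated. -/
theorem integrandRatio_lt_one_of_neg_axis {ϑ t r δ : ℝ} (hϑ : 1 ≤ ϑ) (hδ : 0 < δ)
    (hδ0 : 1 + Real.exp t * (Real.exp (-δ) - 1) = 0) {L : ℂ → ℂ} (hr : 0 < r) (hL : L t = r) {b : ℝ}
    (hb0 : 0 ≤ b) (hb : δ ≤ r * Real.exp (-b)) :
    integrandRatio ϑ L t (Real.pi + b * Complex.I) < 1 := by
  set s := r * Real.exp (-b) with hs
  have hs0 : 0 < s := by positivity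
  have hsr : s ≤ r := by
    have : Real.exp (-b) ≤ 1 := Real.exp_le_one_iff.2 (by linarith)
    rw [hs]; nlinarith
  have hx : L t * Complex.exp ((Real.pi + b * Complex.I) * Complex.I) = ((-s : ℝ) : ℂ) := by
    have e : (Real.pi + b * Complex.I) * Complex.I = Real.pi * Complex.I + ((-b : ℝ) : ℂ) := by
      push_cast; linear_combination (b : ℂ) * Complex.I_mul_I
    rw [hL, e, Complex.exp_add, Complex.exp_pi_mul_I, ← Complex.ofReal_exp, hs]
    push_cast; ring
  have him : (Real.pi + b * Complex.I : ℂ).im = b := by simp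
  have hu : Real.exp t * Real.exp (-δ) = Real.exp t - 1 := by linarith
  have hu1 : 0 < Real.exp t - 1 := by rw [← hu]; positivity
  have hF : ‖stirlingBase t (L t)‖ = (Real.exp t - 1) * (Real.exp (r + δ) - 1) := by
    have e : Real.exp r = Real.exp (-δ) * Real.exp (r + δ) := by rw [← Real.exp_add]; ring_nf
    rw [hL, norm_stirlingBase_ofReal hr]
    linear_combination Real.exp t * e + Real.exp (r + δ) * hu
  have hF' : (Real.exp t - 1) * (r + δ) ≤ ‖stirlingBase t (L t)‖ := by
    rw [hF]
    exact mul_le_mul_of_nonneg_left (by linarith [Real.add_one_le_exp (r + δ)]) hu1.le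
  have hF0 : 0 < ‖stirlingBase t (L t)‖ := lt_of_lt_of_le (by positivity) hF'
  have hG : ‖stirlingBase t ((-s : ℝ) : ℂ)‖ ≤ (Real.exp t - 1) * (s - δ) := by
    have e : 1 + Real.exp t * (Real.exp (-s) - 1) =
        -((Real.exp t - 1) * (1 - Real.exp (-(s - δ)))) := by
      have : Real.exp t * Real.exp (-s) = (Real.exp t - 1) * Real.exp (-(s - δ)) := by
        have e : Real.exp (-s) = Real.exp (-δ) * Real.exp (-(s - δ)) := by
          rw [← Real.exp_add]; ring_nf
        linear_combination Real.exp t * e + Real.exp (-(s - δ)) * hu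
      linear_combination this
    have h1 : Real.exp (-(s - δ)) ≤ 1 := Real.exp_le_one_iff.2 (by linarith)
    rw [stirlingBase_ofReal, Complex.norm_real, e, norm_neg,
      Real.norm_of_nonneg (mul_nonneg hu1.le (by linarith))]
    exact mul_le_mul_of_nonneg_left (by linarith [Real.add_one_le_exp (-(s - δ))]) hu1.le
  set A := ‖stirlingBase t ((-s : ℝ) : ℂ)‖ with hA
  set G := ‖stirlingBase t (L t)‖ with hGdef
  have hq0 : 0 ≤ A / G := div_nonneg (norm_nonneg _) hF0.le
  have hq1 : A / G < s / r := by
    rw [div_lt_div_iff₀ hF0 hr]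
    calc A * r ≤ (Real.exp t - 1) * (s - δ) * r := by gcongr
      _ < (Real.exp t - 1) * (s * (r + δ)) := by
        rw [mul_assoc]
        refine mul_lt_mul_of_pos_left ?_ hu1
        nlinarith
      _ = s * ((Real.exp t - 1) * (r + δ)) := by ring
      _ ≤ s * G := by gcongr
  have hq2 : (A / G) ^ ϑ ≤ A / G := by
    have h1 : A / G ≤ 1 := hq1.le.trans ((div_le_one hr).2 hsr)
    calc (A / G) ^ ϑ ≤ (A / G) ^ (1 : ℝ) :=
          Real.rpow_le_rpow_of_exponent_ge_of_imp hq0 h1 hϑ (fun _ h => by linarith)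
      _ = A / G := Real.rpow_one _
  have hfin : integrandRatio ϑ L t (Real.pi + b * Complex.I) = (A / G) ^ ϑ * Real.exp b := by
    rw [integrandRatio, hx, him, Real.div_rpow (norm_nonneg _) hF0.le]
    ring
  rw [hfin]
  have : s / r * Real.exp b = 1 := by
    rw [hs, mul_div_assoc, mul_comm r, div_mul_cancel₀ _ hr.ne', ← Real.exp_add]; simp
  calc (A / G) ^ ϑ * Real.exp b ≤ A / G * Real.exp b := by gcongr
    _ < s / r * Real.exp b := by gcongr
    _ = 1 := this

theorem continuous_integrandRatio {ϑ : ℝ} (hϑ : 0 < ϑ) (L : ℂ → ℂ) (z : ℂ) :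
    Continuous (integrandRatio ϑ L z) := by
  have h1 : Continuous fun w => stirlingBase z (L z * Complex.exp (w * Complex.I)) := by
    unfold stirlingBase; fun_prop
  exact ((h1.norm.rpow_const fun _ => Or.inr hϑ.le).mul (by fun_prop)).div_const _

/-- If the base is positive at `-r`, the full circle works. Otherwise the contour follows the cut
inwards past its tip `-δ`. -/
theorem IsSaddle.exists_contour {ϑ t r : ℝ} (h : IsSaddle ϑ t r) (hϑ : 1 ≤ ϑ) :
    ∃ α₁ B : ℝ, 0 < α₁ ∧ α₁ ≤ Real.pi ∧ 0 ≤ B ∧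
      (∀ a > 0, ∀ w ∈ contourEdges a α₁ B, integrandRatio ϑ (sibuyaL ϑ) t w < 1) ∧
      SlitCondition α₁ B t (sibuyaL ϑ t) := by
  have hϑ0 : 0 < ϑ := by linarith
  have hL := h.sibuyaL_eq hϑ0
  have hr := h.pos
  by_cases hneg : 0 < 1 + Real.exp t * (Real.exp (-r) - 1)
  · have key : ∀ x : ℂ, ‖x‖ ≤ r → stirlingBase t x ∈ Complex.slitPlane := by
      refine fun x hx => stirlingBase_mem_slitPlane h hϑ hx fun _ => ?_
      have h1 : -r ≤ x.re := by linarith [(abs_le.1 (Complex.abs_re_le_norm x)).1]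
      have := mul_le_mul_of_nonneg_left (Real.exp_le_exp.2 h1) (Real.exp_pos t).le
      linarith
    refine ⟨Real.pi, 0, Real.pi_pos, le_rfl, le_rfl, ?_, ?_, ?_⟩
    · exact fun a ha w hw => integrandRatio_lt_one_of_mem_contourEdges_pi_zero hϑ0 hr hL ha hw
    · intro w hw
      refine key _ ?_
      rw [hL, norm_ofReal_mul_exp_mul_I hr.le, le_antisymm hw.2.2 hw.2.1]
      simp
    · intro y hy
      refine key _ ?_
      rw [mem_closedBall_zero_iff, neg_zero, Real.exp_zero] at hy
      rw [hL, norm_mul, Complex.norm_real, Real.norm_of_nonneg hr.le]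
      nlinarith
  · push Not at hneg
    obtain ⟨δ, hδ, hδr, hδ0⟩ : ∃ δ : ℝ, 0 < δ ∧ δ ≤ r ∧
        1 + Real.exp t * (Real.exp (-δ) - 1) = 0 := by
      have hc : Continuous fun δ : ℝ => 1 + Real.exp t * (Real.exp (-δ) - 1) := by fun_prop
      obtain ⟨δ, hδ, hδ0⟩ := intermediate_value_Icc' hr.le hc.continuousOn
        ⟨hneg, by simp⟩
      refine ⟨δ, lt_of_le_of_ne hδ.1 fun h0 => ?_, hδ.2, hδ0⟩
      simp [← h0] at hδ0
    -- Height in logarithmic coordinates at which the radius equals `δ`, the tip of the cut.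
    set b₀ := Real.log (r / δ) with hb₀
    have hb₀0 : 0 ≤ b₀ := Real.log_nonneg ((one_le_div hδ).2 hδr)
    have hb₀e : r * Real.exp (-b₀) = δ := by
      rw [hb₀, Real.exp_neg, Real.exp_log (by positivity)]; field_simp
    set U := {w : ℂ | integrandRatio ϑ (sibuyaL ϑ) t w < 1} with hU
    have hUo : IsOpen U := isOpen_lt (continuous_integrandRatio hϑ0 _ _) continuous_const
    set S := (fun b : ℝ => (Real.pi + b * Complex.I : ℂ)) '' Set.Icc 0 b₀ with hS
    have hSc : IsCompact S := isCompact_Icc.image (by fun_prop)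
    have hSU : S ⊆ U := by
      rintro _ ⟨b, hb, rfl⟩
      refine integrandRatio_lt_one_of_neg_axis hϑ hδ hδ0 hr hL hb.1 ?_
      rw [← hb₀e]
      have : Real.exp (-b₀) ≤ Real.exp (-b) := Real.exp_le_exp.2 (by linarith [hb.2])
      gcongr
    obtain ⟨ε, hε, hεU⟩ := hSc.exists_thickening_subset_open hUo hSU
    -- The vertical sides move from `±π` inwards by `e`, and the top moves up by `e` to pass
    -- strictly inside radius `δ`. Each coordinate changes by at most `ε/3`, so the points stay in
    -- the thickening.
    set e := min 1 (ε / 3) with he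
    have he0 : 0 < e := by positivity
    have he1 : e ≤ 1 := min_le_left _ _
    have heε : e ≤ ε / 3 := min_le_right _ _
    have hpi := Real.pi_gt_three
    have hmem : ∀ w : ℂ, Real.pi - e ≤ w.re → w.re ≤ Real.pi → 0 ≤ w.im → w.im ≤ b₀ + e →
        w ∈ U := by
      intro w h1 h2 h3 h4
      refine hεU (Metric.mem_thickening_iff.2
        ⟨_, ⟨min w.im b₀, ⟨le_min h3 hb₀0, min_le_right _ _⟩, rfl⟩, ?_⟩)
      rw [dist_eq_norm]
      refine (Complex.norm_le_abs_re_add_abs_im _).trans_lt ?_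
      have e1 : |(w - (Real.pi + (min w.im b₀ : ℝ) * Complex.I)).re| ≤ e := by
        simp only [Complex.sub_re, Complex.add_re, Complex.ofReal_re, Complex.mul_re, Complex.I_re,
          mul_zero, Complex.ofReal_im, Complex.I_im, mul_one, sub_zero, add_zero]
        rw [abs_le]; constructor <;> linarith
      have e2 : |(w - (Real.pi + (min w.im b₀ : ℝ) * Complex.I)).im| ≤ e := by
        simp only [Complex.sub_im, Complex.add_im, Complex.ofReal_im, Complex.mul_im, Complex.I_re,
          mul_zero, Complex.ofReal_re, Complex.I_im, mul_one, zero_add, add_zero]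
        rcases le_total w.im b₀ with h5 | h5
        · rw [min_eq_left h5]; simp [he0.le]
        · rw [min_eq_right h5, abs_le]; constructor <;> linarith
      linarith
    have hmem' : ∀ w : ℂ, Real.pi - e ≤ |w.re| → |w.re| ≤ Real.pi → 0 ≤ w.im → w.im ≤ b₀ + e →
        integrandRatio ϑ (sibuyaL ϑ) t w < 1 := by
      intro w h1 h2 h3 h4
      rcases le_total 0 w.re with h5 | h5
      · rw [abs_of_nonneg h5] at h1 h2
        exact hmem w h1 h2 h3 h4
      · rw [abs_of_nonpos h5] at h1 h2
        rw [← integrandRatio_neg_conj hL]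
        exact hmem _ (by simpa using h1) (by simpa using h2) (by simpa using h3) (by simpa using h4)
    refine ⟨Real.pi - e, b₀ + e, by linarith, by linarith, by linarith, ?_, ?_, ?_⟩
    · rintro a ha w ((⟨h1, h2⟩ | ⟨h1, h2⟩) | ⟨h1, h2⟩)
      · exact hmem' w h1.ge (by linarith) h2.1 h2.2
      · exact hmem' w h1.1 h1.2 (by linarith) h2.le
      · exact integrandRatio_lt_one_of_im_eq_zero hϑ0 hr hL h2 (ha.trans_le h1.1)
          (by linarith [h1.2])
    · intro w hw
      obtain ⟨hw1, hw2⟩ := hw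
      have hw1' : w.re ∈ Set.Icc (-(Real.pi - e)) (Real.pi - e) := hw1
      have hw2' : w.im ∈ Set.Icc 0 (b₀ + e) := hw2
      have hn : Real.exp (-w.im) ≤ 1 := Real.exp_le_one_iff.2 (by linarith [hw2'.1])
      rw [hL]
      refine stirlingBase_mem_slitPlane h hϑ ?_ fun hi => ?_
      · rw [norm_ofReal_mul_exp_mul_I hr.le]; nlinarith
      · rw [Complex.im_ofReal_mul, Complex.exp_im] at hi
        have hs : Real.sin w.re = 0 := by
          have := (mul_eq_zero.1 ((mul_eq_zero.1 hi).resolve_left hr.ne')).resolve_left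
            (Real.exp_pos _).ne'
          simpa using this
        have h0 := (Real.sin_eq_zero_iff_of_lt_of_lt (by linarith [hw1'.1])
          (by linarith [hw1'.2])).1 hs
        refine stirlingBase_pos_of_lt hδ0.ge ?_
        rw [Complex.re_ofReal_mul, Complex.exp_re]
        have : (w * Complex.I).im = 0 := by simpa using h0
        rw [this, Real.cos_zero, mul_one]
        have : 0 < r * Real.exp (w * Complex.I).re := by positivity
        linarith
    · intro y hy
      rw [mem_closedBall_zero_iff] at hy
      have hlt : ‖(r : ℂ) * y‖ < δ := by
        rw [norm_mul, Complex.norm_real, Real.norm_of_nonneg hr.le, ← hb₀e]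
        have : Real.exp (-(b₀ + e)) < Real.exp (-b₀) := Real.exp_lt_exp.2 (by linarith)
        exact mul_lt_mul_of_pos_left (hy.trans_lt this) hr
      rw [hL]
      refine stirlingBase_mem_slitPlane h hϑ (hlt.le.trans hδr) fun _ => ?_
      refine stirlingBase_pos_of_lt hδ0.ge ?_
      linarith [(abs_le.1 (Complex.abs_re_le_norm ((r : ℂ) * y))).1]

/-! ### The uniform rate and the main theorem -/

/-- Mere continuity for a fixed `n`; it covers the finitely many non-integral exponents when `ϑ <
1`. -/
theorem IsSaddle.eventually_norm_sub_lt {ϑ t r : ℝ} (h : IsSaddle ϑ t r) (hϑ : 0 < ϑ) {n : ℕ}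
    (hn : StirlingSibuyaAdmissible n (ϑ * n)) : ∃ c : ℝ, 0 ≤ c ∧ ∀ᶠ z in 𝓝 (t : ℂ),
      ‖normalizedLaplace (stirlingSibuya n (ϑ * n)) n (sibuyaPhi ϑ) z - sibuyaPsi ϑ z‖ < c := by
  have h1 : ContinuousAt (complexMGF id (stirlingSibuya n (ϑ * n))) (t : ℂ) := by
    rw [funext (complexMGF_stirlingSibuya hn)]
    exact (continuous_finsetSum _ fun k _ => by fun_prop).continuousAt.div_const _
  have h2 : ContinuousAt (fun z => normalizedLaplace (stirlingSibuya n (ϑ * n)) n (sibuyaPhi ϑ) z -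
      sibuyaPsi ϑ z) (t : ℂ) :=
    (h1.div (continuousAt_const.mul (h.analyticAt_sibuyaPhi hϑ).continuousAt).cexp
      (Complex.exp_ne_zero _)).sub (h.analyticAt_sibuyaPsi hϑ).continuousAt
  exact ⟨‖normalizedLaplace (stirlingSibuya n (ϑ * n)) n (sibuyaPhi ϑ) t - sibuyaPsi ϑ t‖ + 1,
    by positivity, h2.norm.eventually_lt continuousAt_const (by linarith)⟩

theorem IsSaddle.eventually_norm_sub_le {ϑ t r : ℝ} (h : IsSaddle ϑ t r) (hϑ : 0 < ϑ) :
    ∃ C : ℝ, ∀ᶠ z in 𝓝 (t : ℂ), ∀ n : ℕ, StirlingSibuyaAdmissible n (ϑ * n) →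
      ‖normalizedLaplace (stirlingSibuya n (ϑ * n)) n (sibuyaPhi ϑ) z - sibuyaPsi ϑ z‖ ≤ C / n := by
  rcases le_or_gt 1 ϑ with h1 | h1
  · obtain ⟨α₁, B, hα0, hα, hB, hE, hS⟩ := h.exists_contour h1
    obtain ⟨C, hC⟩ := h.local_asymptotics hϑ hα0 hα hB hE
    exact ⟨C, hC.mono fun z hz n hn => hz n hn (Or.inl hS)⟩
  · obtain ⟨C, hC⟩ := h.local_asymptotics hϑ Real.pi_pos le_rfl le_rfl fun a ha w hw =>
      integrandRatio_lt_one_of_mem_contourEdges_pi_zero hϑ h.pos (h.sibuyaL_eq hϑ) ha hw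
    -- For `ϑ < 1`, `ϑn > n - 1` means `n < 1/(1 - ϑ)`, so every admissible `n ≥ N` has `ϑn`
    -- integral.
    obtain ⟨N, hN⟩ := exists_nat_gt (1 / (1 - ϑ))
    have hc : ∀ n : ℕ, ∃ c : ℝ, 0 ≤ c ∧ (StirlingSibuyaAdmissible n (ϑ * n) →
        ∀ᶠ z in 𝓝 (t : ℂ), ‖normalizedLaplace (stirlingSibuya n (ϑ * n)) n (sibuyaPhi ϑ) z -
          sibuyaPsi ϑ z‖ < c) := by
      intro n
      by_cases hn : StirlingSibuyaAdmissible n (ϑ * n)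
      · obtain ⟨c, hc0, hc⟩ := h.eventually_norm_sub_lt hϑ hn
        exact ⟨c, hc0, fun _ => hc⟩
      · exact ⟨0, le_rfl, fun h => absurd h hn⟩
    choose c hc0 hc using hc
    have hfin : ∀ᶠ z in 𝓝 (t : ℂ), ∀ n ∈ Finset.range N, StirlingSibuyaAdmissible n (ϑ * n) →
        ‖normalizedLaplace (stirlingSibuya n (ϑ * n)) n (sibuyaPhi ϑ) z - sibuyaPsi ϑ z‖ < c n := by
      rw [eventually_all_finset]
      intro n _
      by_cases hn : StirlingSibuyaAdmissible n (ϑ * n)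
      · exact (hc n hn).mono fun z hz _ => hz
      · exact Eventually.of_forall fun z h => absurd h hn
    -- The factor `n` in each summand converts the bound `c n` into the form `C / n`.
    refine ⟨|C| + ∑ n ∈ Finset.range N, c n * n, ?_⟩
    have hsum : 0 ≤ ∑ n ∈ Finset.range N, c n * n :=
      Finset.sum_nonneg fun n _ => mul_nonneg (hc0 n) n.cast_nonneg
    filter_upwards [hC, hfin] with z hz1 hz2 n hn
    have hn0 : (0 : ℝ) < n := by exact_mod_cast hn.1
    rw [le_div_iff₀ hn0]
    rcases hn.2.2 with hm | hlt
    · have := hz1 n hn (Or.inr hm)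
      rw [le_div_iff₀ hn0] at this
      linarith [le_abs_self C]
    · have hnN : n ∈ Finset.range N := by
        rw [Finset.mem_range]
        have : (n : ℝ) < 1 / (1 - ϑ) := by
          rw [lt_div_iff₀ (by linarith)]; linarith
        exact_mod_cast this.trans hN
      have h2 := mul_le_mul_of_nonneg_right (hz2 n hnN hn).le hn0.le
      have h3 := Finset.single_le_sum (f := fun n : ℕ => c n * n)
        (fun n _ => mul_nonneg (hc0 n) n.cast_nonneg) hnN
      linarith [abs_nonneg C]

/-- Every ball is centred on the real line, which is connected and lies in the union. -/
theorem isConnected_iUnion_ball_ofReal {ε : ℝ → ℝ} (hε : ∀ t, 0 < ε t) :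
    IsConnected (⋃ t : ℝ, Metric.ball (t : ℂ) (ε t)) := by
  have hmem : ∀ t : ℝ, (t : ℂ) ∈ ⋃ t : ℝ, Metric.ball (t : ℂ) (ε t) := fun t =>
    Set.mem_iUnion.2 ⟨t, Metric.mem_ball_self (hε t)⟩
  refine ⟨⟨_, hmem 0⟩, isPreconnected_of_forall ((0 : ℝ) : ℂ) fun y hy => ?_⟩
  obtain ⟨t, ht⟩ := Set.mem_iUnion.1 hy
  refine ⟨Set.range ((↑) : ℝ → ℂ) ∪ Metric.ball (t : ℂ) (ε t), Set.union_subset ?_ ?_,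
    Or.inl ⟨0, rfl⟩, Or.inr ht, ?_⟩
  · rintro _ ⟨s, rfl⟩; exact hmem s
  · exact Set.subset_iUnion (fun t : ℝ => Metric.ball (t : ℂ) (ε t)) t
  · exact IsPreconnected.union (t : ℂ) ⟨t, rfl⟩ (Metric.mem_ball_self (hε t))
      (isPreconnected_range Complex.continuous_ofReal) (convex_ball _ _).isPreconnected

theorem mainTheorem3 (ϑ : ℝ) (hϑ : 0 < ϑ) :
    ∃ D : Set ℂ, IsOpen D ∧ (∀ t : ℝ, (t : ℂ) ∈ D) ∧
      -- all principal branches in the formulas are evaluated off their cuts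
      (∀ z ∈ D, sibuyaArg ϑ z ∈ lambertDomain ∧ sibuyaL ϑ z ∈ Complex.slitPlane ∧
        (ϑ : ℂ) / ((ϑ : ℂ) * sibuyaL ϑ z + (ϑ : ℂ) - 1) ∈ Complex.slitPlane) ∧
      -- mod-phi convergence with speed `n`
      IsModPhiConvergent {n : ℕ | StirlingSibuyaAdmissible n (ϑ * n)}
        (fun n => stirlingSibuya n (ϑ * n)) ⊥ ⊤ (fun n => (n : ℝ)) D
        (sibuyaPhi ϑ) (sibuyaPsi ϑ) ∧
      -- the convergence holds locally uniformly with rate `O(1/n)`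
      (∀ K ⊆ D, IsCompact K → ∃ C : ℝ, ∀ n : ℕ, StirlingSibuyaAdmissible n (ϑ * n) → ∀ z ∈ K,
        ‖normalizedLaplace (stirlingSibuya n (ϑ * n)) n (sibuyaPhi ϑ) z - sibuyaPsi ϑ z‖
          ≤ C / n) := by
  choose ρ hρ using fun t => exists_isSaddle hϑ t
  choose C hC using fun t => (hρ t).eventually_norm_sub_le hϑ
  have hev : ∀ t : ℝ, ∀ᶠ z in 𝓝 (t : ℂ), (sibuyaArg ϑ z ∈ lambertDomain ∧
      sibuyaL ϑ z ∈ Complex.slitPlane ∧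
      (ϑ : ℂ) / ((ϑ : ℂ) * sibuyaL ϑ z + (ϑ : ℂ) - 1) ∈ Complex.slitPlane) ∧
      AnalyticAt ℂ (sibuyaPhi ϑ) z ∧ AnalyticAt ℂ (sibuyaPsi ϑ) z ∧
      ∀ n : ℕ, StirlingSibuyaAdmissible n (ϑ * n) →
        ‖normalizedLaplace (stirlingSibuya n (ϑ * n)) n (sibuyaPhi ϑ) z - sibuyaPsi ϑ z‖ ≤
          C t / n := by
    intro t
    have h := hρ t
    have h1 : ContinuousAt (sibuyaArg ϑ) t := by unfold sibuyaArg; fun_prop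
    filter_upwards [h1.eventually_mem (isOpen_lambertDomain.mem_nhds (h.sibuyaArg_mem hϑ)),
      (h.analyticAt_sibuyaL hϑ).continuousAt.eventually_mem
        (Complex.isOpen_slitPlane.mem_nhds (h.sibuyaL_mem_slitPlane hϑ)),
      (h.analyticAt_quotient hϑ).continuousAt.eventually_mem
        (Complex.isOpen_slitPlane.mem_nhds (h.psi_mem_slitPlane hϑ)),
      (h.analyticAt_sibuyaPhi hϑ).eventually_analyticAt,
      (h.analyticAt_sibuyaPsi hϑ).eventually_analyticAt, hC t] with z z1 z2 z3 z4 z5 z6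
    exact ⟨⟨z1, z2, z3⟩, z4, z5, z6⟩
  choose ε hε hball using fun t => Metric.eventually_nhds_iff_ball.1 (hev t)
  set D : Set ℂ := ⋃ t : ℝ, Metric.ball (t : ℂ) (ε t) with hD
  have hDopen : IsOpen D := isOpen_iUnion fun t => Metric.isOpen_ball
  have hDreal : ∀ t : ℝ, (t : ℂ) ∈ D := fun t =>
    Set.mem_iUnion.2 ⟨t, Metric.mem_ball_self (hε t)⟩
  have hrate : ∀ K ⊆ D, IsCompact K → ∃ C : ℝ, ∀ n : ℕ, StirlingSibuyaAdmissible n (ϑ * n) →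
      ∀ z ∈ K, ‖normalizedLaplace (stirlingSibuya n (ϑ * n)) n (sibuyaPhi ϑ) z - sibuyaPsi ϑ z‖
        ≤ C / n := by
    intro K hKD hK
    -- Having a common constant passes to subsets and finite unions and holds on each ball, so
    -- compactness gives it on `K`.
    refine hK.induction_on ⟨0, by simp⟩ ?_ ?_ ?_
    · rintro s s' hss ⟨C, hC⟩
      exact ⟨C, fun n hn z hz => hC n hn z (hss hz)⟩
    · rintro s s' ⟨C₁, hC₁⟩ ⟨C₂, hC₂⟩
      refine ⟨max C₁ C₂, fun n hn z hz => ?_⟩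
      rcases hz with hz | hz
      · exact (hC₁ n hn z hz).trans (by gcongr; exact le_max_left _ _)
      · exact (hC₂ n hn z hz).trans (by gcongr; exact le_max_right _ _)
    · intro z hz
      obtain ⟨t, ht⟩ := Set.mem_iUnion.1 (hKD hz)
      exact ⟨_, mem_nhdsWithin_of_mem_nhds (Metric.isOpen_ball.mem_nhds ht), C t,
        fun n hn w hw => (hball t w hw).2.2.2 n hn⟩
  refine ⟨D, hDopen, hDreal, fun z hz => ?_, ?_, hrate⟩
  · obtain ⟨t, ht⟩ := Set.mem_iUnion.1 hz
    exact (hball t z ht).1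
  · refine ⟨fun n hn => isProbabilityMeasure_stirlingSibuya hn, bot_lt_top,
      fun n _ t _ _ => mem_integrableExpSet_stirlingSibuya _ _ _, fun n hn => ?_,
      tendsto_natCast_atTop_atTop.mono_left inf_le_left, hDopen,
      isConnected_iUnion_ball_ofReal hε, fun z _ => ⟨EReal.bot_lt_coe _, EReal.coe_lt_top _⟩,
      fun t _ _ => hDreal t, fun z hz => ?_, fun t _ _ => (hρ t).sibuyaPhi_im hϑ, ?_,
      fun z hz => ?_, fun t _ => (hρ t).sibuyaPsi_ne_zero hϑ, fun K hKD hK => ?_⟩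
    · exact_mod_cast hn.1
    · obtain ⟨t, ht⟩ := Set.mem_iUnion.1 hz
      exact (hball t z ht).2.1
    · have : {t : ℝ | (⊥ : EReal) < t ∧ (t : EReal) < ⊤} = Set.univ :=
        Set.eq_univ_of_forall fun t => ⟨EReal.bot_lt_coe _, EReal.coe_lt_top _⟩
      rw [this]
      exact strictConvexOn_sibuyaPhi_re hϑ
    · obtain ⟨t, ht⟩ := Set.mem_iUnion.1 hz
      exact (hball t z ht).2.2.1
    · obtain ⟨C, hC⟩ := hrate K hKD hK
      rw [Metric.tendstoUniformlyOn_iff]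
      intro δ hδ
      rw [eventually_inf_principal]
      have h0 : Tendsto (fun n : ℕ => C / n) atTop (𝓝 0) := tendsto_const_div_atTop_nhds_zero_nat C
      filter_upwards [h0.eventually_lt_const hδ] with n hn hnS z hz
      rw [dist_comm, dist_eq_norm]
      exact (hC n hnS z hz).trans_lt hn
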